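/- Let $(M^n,\widehat g)$ be a complete noncompact Kähler manifold (of complex dimension $n$), and suppose there is a $C^2$ function $\zeta>0$ on $M$ with $\lim_{x\to\infty}\zeta(x)=\infty$ such that $|\partial\bar\partial\zeta|_{\widehat g}$ and $|\widehat\nabla\zeta|_{\widehat g}$ are bounded on $M$. Here $x\to\infty$ means that $x$ leaves every compact subset of $M$. Let $T>0$ and let $g_1(x,t)$, $g_2(x,t)$ be two solutions on $M\times[0,T]$ of the Kähler–Ricci flow $\frac{\partial}{\partial t}g_{i\bar\jmath}=-R_{i\bar\jmath}$ with the same initial data $g_1(x,0)=g_2(x,0)$; that is, families of Hermitian metrics which are continuous on $M\times[0,T]$ and smooth on $M\times(0,T)$, and which are Kähler and satisfy the equation for $t\in(0,T)$, where $R_{i\bar\jmath}$ is the Ricci tensor of $g(t)$. (a) Suppose there is a function $\sigma>0$ on $M$ with $\lim_{x\to\infty}\log\sigma(x)/\log\zeta(x)=0$ such that for all $(x,t)\in M\times[0,T]$: (i) $\widehat g(x)\le\zeta(x)\,g_1(x,t)$ and $\widehat g(x)\le\zeta(x)\,g_2(x,t)$; (ii) $-\sigma(x)\le\dfrac{\det\big((g_1)_{i\bar\jmath}(x,t)\big)}{\det\big((g_2)_{i\bar\jmath}(x,t)\big)}\le\sigma(x)$,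 the determinants being taken in the same local holomorphic coordinates around $x$. Then $g_1\equiv g_2$ on $M\times[0,T]$. (b) In particular, if $g_1$ and $g_2$ are uniformly equivalent to $\widehat g$ on $M\times[0,T]$, i.e. for some constant $K>0$ one has $K^{-1}\widehat g\le g_k(\cdot,t)\le K\widehat g$ on $M$ for all $t\in[0,T]$ and $k=1,2$, then $g_1\equiv g_2$ on $M\times[0,T]$. -/

import Mathlib

open scoped Manifold ContDiff Topology
open Set Filter

noncomputable section

namespace KahlerFlow

/-- The model space `ℂⁿ`. -/
abbrev Cn (n : ℕ) : Type := EuclideanSpace ℂ (Fin n)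

/-- The `i`-th standard basis vector of `ℂⁿ`. -/
def stdVec (n : ℕ) (i : Fin n) : Cn n := EuclideanSpace.single i 1

/-- The Wirtinger derivative `∂f/∂zₖ = ½ (∂f/∂xₖ - √-1 ∂f/∂yₖ)`. -/
def dz {n : ℕ} (k : Fin n) (f : Cn n → ℂ) (z : Cn n) : ℂ :=
  (1 / 2) * (fderiv ℝ f z (stdVec n k) - Complex.I * fderiv ℝ f z (Complex.I • stdVec n k))

/-- The Wirtinger derivative `∂f/∂z̄ₖ = ½ (∂f/∂xₖ + √-1 ∂f/∂yₖ)`. -/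
def dzbar {n : ℕ} (k : Fin n) (f : Cn n → ℂ) (z : Cn n) : ℂ :=
  (1 / 2) * (fderiv ℝ f z (stdVec n k) + Complex.I * fderiv ℝ f z (Complex.I • stdVec n k))

section LocalFormulas

variable {n : ℕ}

/-- The entries `g^{i j̄}` of the inverse of `(g_{i j̄})`, with `∑ⱼ g^{i j̄} g_{k j̄} = δ_{ik}`. -/
def upper (G : Matrix (Fin n) (Fin n) ℂ) (i j : Fin n) : ℂ := G⁻¹ j i

/-- The curvature tensor in holomorphic coordinates,
`R_{i j̄ k l̄} = -∂ₖ ∂_{l̄} g_{i j̄} + g^{p q̄} ∂ₖ g_{i q̄} ∂_{l̄} g_{p j̄}`,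
of the metric with coefficients `g_{i j̄} = G · i j`. -/
def curvature (G : Cn n → Matrix (Fin n) (Fin n) ℂ) (z : Cn n) (i j k l : Fin n) : ℂ :=
  -dz k (dzbar l fun y => G y i j) z
    + ∑ p, ∑ q, upper (G z) p q * dz k (fun y => G y i q) z * dzbar l (fun y => G y p j) z

/-- The Ricci tensor in holomorphic coordinates, `R_{k l̄} = g^{i j̄} R_{i j̄ k l̄}`. -/
def ricci (G : Cn n → Matrix (Fin n) (Fin n) ℂ) (z : Cn n) (k l : Fin n) : ℂ :=
  ∑ i, ∑ j, upper (G z) i j * curvature G z i j k l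

/-- The squared length `g^{i j̄} fᵢ f_{j̄}` of the gradient of `f`. -/
def gradNormSq (G : Cn n → Matrix (Fin n) (Fin n) ℂ) (f : Cn n → ℂ) (z : Cn n) : ℝ :=
  (∑ i, ∑ j, upper (G z) i j * dz i f z * dzbar j f z).re

/-- The squared norm `g^{i l̄} g^{k j̄} f_{i j̄} f_{k l̄}` of the form `∂∂̄f`, for real-valued `f`. -/
def ddbarNormSq (G : Cn n → Matrix (Fin n) (Fin n) ℂ) (f : Cn n → ℂ) (z : Cn n) : ℝ :=
  (∑ i, ∑ j, ∑ k, ∑ l,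
    upper (G z) i l * upper (G z) k j * dz i (dzbar j f) z * dz k (dzbar l f) z).re

end LocalFormulas

variable (n : ℕ) (M : Type*) [TopologicalSpace M] [ChartedSpace (Cn n) M]

/-- A (pointwise) Hermitian metric on the holomorphic tangent bundle: a positive definite
Hermitian form, conjugate linear in the first argument, on every tangent space. -/
@[ext] structure HermitianMetric where
  form : ∀ x : M, TangentSpace 𝓘(ℂ, Cn n) x →ₗ⋆[ℂ] TangentSpace 𝓘(ℂ, Cn n) x →ₗ[ℂ] ℂ
  conj_symm : ∀ (x : M) (v w : TangentSpace 𝓘(ℂ, Cn n) x),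
    (starRingEnd ℂ) (form x v w) = form x w v
  pos : ∀ (x : M) (v : TangentSpace 𝓘(ℂ, Cn n) x), v ≠ 0 → 0 < (form x v v).re

variable {n M}

namespace HermitianMetric

/-- The squared length of a tangent vector. -/
def normSq (g : HermitianMetric n M) (x : M) (v : TangentSpace 𝓘(ℂ, Cn n) x) : ℝ :=
  (g.form x v v).re

/-- The coefficients `g_{i j̄} = g(∂ᵢ, ∂_{j̄})` of the metric in the holomorphic chart `c`, as
functions on the target of `c`. -/
def coeff (g : HermitianMetric n M) (c : OpenPartialHomeomorph M (Cn n)) (z : Cn n) :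
    Matrix (Fin n) (Fin n) ℂ :=
  Matrix.of fun i j => g.form (c.symm z)
    (mfderiv 𝓘(ℂ, Cn n) 𝓘(ℂ, Cn n) c.symm z (stdVec n j))
    (mfderiv 𝓘(ℂ, Cn n) 𝓘(ℂ, Cn n) c.symm z (stdVec n i))

/-- A Kähler metric: smooth coefficients in the charts, and closed fundamental form, that is
`∂ₖ g_{i j̄} = ∂ᵢ g_{k j̄}`. -/
structure IsKahler (g : HermitianMetric n M) : Prop where
  smooth : ∀ c ∈ atlas (Cn n) M, ∀ i j,
    ContDiffOn ℝ ∞ (fun z => g.coeff c z i j) c.target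
  closed : ∀ c ∈ atlas (Cn n) M, ∀ z ∈ c.target, ∀ i j k,
    dz k (fun y => g.coeff c y i j) z = dz i (fun y => g.coeff c y k j) z

/-- The distance of the metric: the infimum of the lengths of `C¹` curves. -/
def dist (g : HermitianMetric n M) (x y : M) : ENNReal :=
  letI : ∀ x : M, ENorm (TangentSpace 𝓘(ℝ, Cn n) x) :=
    fun x => ⟨fun v => ENNReal.ofReal (Real.sqrt (g.normSq x v))⟩
  Manifold.riemannianEDist 𝓘(ℝ, Cn n) x y

/-- Completeness: every Cauchy sequence for the distance of the metric converges in `M`. -/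
def IsComplete (g : HermitianMetric n M) : Prop :=
  ∀ u : ℕ → M, (∀ ε : ENNReal, 0 < ε → ∃ N, ∀ a ≥ N, ∀ b ≥ N, g.dist (u a) (u b) < ε) →
    ∃ x, Tendsto u atTop (𝓝 x)

end HermitianMetric

/-- `g(t)`, `t ∈ [0, T]`, is a solution of the Kähler-Ricci flow `∂g_{i j̄}/∂t = -R_{i j̄}`
on `M × [0, T]`: it is continuous on `M × [0, T]`, smooth on `M × (0, T)`, and on `(0, T)` it
consists of Kähler metrics that satisfy the equation in every chart. -/
structure IsKahlerRicciFlow (T : ℝ) (g : ℝ → HermitianMetric n M) : Prop where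
  continuous : ∀ c ∈ atlas (Cn n) M, ∀ i j,
    ContinuousOn (fun p : ℝ × Cn n => (g p.1).coeff c p.2 i j) (Icc 0 T ×ˢ c.target)
  smooth : ∀ c ∈ atlas (Cn n) M, ∀ i j,
    ContDiffOn ℝ ∞ (fun p : ℝ × Cn n => (g p.1).coeff c p.2 i j) (Ioo 0 T ×ˢ c.target)
  kahler : ∀ t ∈ Ioo 0 T, (g t).IsKahler
  flow : ∀ c ∈ atlas (Cn n) M, ∀ z ∈ c.target, ∀ t ∈ Ioo 0 T, ∀ i j,
    HasDerivAt (fun s => (g s).coeff c z i j) (-ricci ((g t).coeff c) z i j) t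

/-- An exhaustion function `ζ > 0` of class `C²`, tending to infinity at infinity, such that
`|∇ζ|` and `|∂∂̄ζ|` with respect to the metric `g` are bounded. -/
structure IsBoundedExhaustion (g : HermitianMetric n M) (ζ : M → ℝ) : Prop where
  contMDiff : ContMDiff 𝓘(ℝ, Cn n) 𝓘(ℝ, ℝ) 2 ζ
  pos : ∀ x, 0 < ζ x
  tendsto : Tendsto ζ (cocompact M) atTop
  grad_bounded : ∃ C : ℝ, ∀ c ∈ atlas (Cn n) M, ∀ z ∈ c.target,
    gradNormSq (g.coeff c) (fun y => (ζ (c.symm y) : ℂ)) z ≤ C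
  ddbar_bounded : ∃ C : ℝ, ∀ c ∈ atlas (Cn n) M, ∀ z ∈ c.target,
    ddbarNormSq (g.coeff c) (fun y => (ζ (c.symm y) : ℂ)) z ≤ C

/-- The quotient `det(g_{i j̄}) / det(h_{i j̄})`, in the chart `c`, at the point `x`. -/
def detRatio (g h : HermitianMetric n M) (c : OpenPartialHomeomorph M (Cn n)) (x : M) : ℝ :=
  ((g.coeff c (c x)).det / (h.coeff c (c x)).det).re

/-- `g(t)` is uniformly equivalent to `h` on `M × [0, T]`. -/
def UniformlyEquivalent (T : ℝ) (g : ℝ → HermitianMetric n M) (h : HermitianMetric n M) : Prop :=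
  ∃ K : ℝ, 0 < K ∧ ∀ t ∈ Icc 0 T, ∀ (x : M) (v : TangentSpace 𝓘(ℂ, Cn n) x),
    K⁻¹ * h.normSq x v ≤ (g t).normSq x v ∧ (g t).normSq x v ≤ K * h.normSq x v

end KahlerFlow

end

/-! Let F = log (det g₂ / det g₁) and let φ(x, t) be the integral of F(x, s) over 0 ≤ s ≤ t. The
Ricci tensor is -∂∂̄ log det (`ricci_eq_neg_ddbar_log_det`), so the flow reads ∂g/∂t = ∂∂̄ log det
g. Hence ∂∂̄φ = g₂ - g₁ (`levi_integral_log_det`), and φ solves the parabolic Monge-Ampère equation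
∂φ/∂t = log (det (g₁ + ∂∂̄φ) / det g₁) with φ = 0 at time 0. It suffices to show φ ≤ 0: exchanging
the flows gives φ = 0, so F = 0, the Ricci tensors agree, and g₁ - g₂ is constant in time
(`eq_of_le`).

The inequality φ ≤ 0 is a maximum principle with the barrier b = -log u, u = 1 - log (ζ + L) / R,
which becomes infinite on a compact level set of ζ. Since F is bounded on the compact sublevel set,
φ minus a multiple of b has an interior maximum. Bounded ∂ζ and ∂∂̄ζ together with ĝ ≤ (ζ + K) g₁
give ∂∂̄b ≤ (C / R) u⁻² g₁ (`exists_levi_barrier_le`). At the maximum this yields g₂ ≤ (1 + η + β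
u⁻²) g₁ with β = O(1 / R), hence F ≤ n log (1 + η + β u⁻²) (`logDet_sub_le_of_isLocalMax`). The
factor u⁻² is harmless because log u⁻² = 2b: the comparison function (n + 1)(t + 1)(log A + 2b)
increases in time faster than F allows (`exists_integral_le_barrier`). Letting R tend to infinity at
a fixed point removes the barrier.

The flows are smooth only for positive times, so the argument starts at a small δ > 0. The boundary
term g₂(δ) - g₁(δ) is at most η g₁ on the compact set in question, by continuity and the common
initial metric. -/

namespace KahlerFlow

/-! ### Derivatives of determinants and inverse matrices -/

section Determinant

variable {ι : Type*} [Fintype ι] [DecidableEq ι]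
variable {E : Type*} [NormedAddCommGroup E] [NormedSpace ℝ E]

theorem contDiffAt_det {k : WithTop ℕ∞} {G : E → Matrix ι ι ℂ} {z : E}
    (h : ∀ i j, ContDiffAt ℝ k (fun y => G y i j) z) :
    ContDiffAt ℝ k (fun y => (G y).det) z := by
  simp only [Matrix.det_apply]
  refine ContDiffAt.sum fun σ _ => ?_
  exact (contDiffAt_prod fun i _ => h _ _).const_smul (R := ℤˣ) _

theorem contDiffAt_inv_apply {k : WithTop ℕ∞} {G : E → Matrix ι ι ℂ} {z : E}
    (h : ∀ i j, ContDiffAt ℝ k (fun y => G y i j) z) (hdet : (G z).det ≠ 0) (i j : ι) :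
    ContDiffAt ℝ k (fun y => (G y)⁻¹ i j) z := by
  have h2 : ContDiffAt ℝ k (fun y => (G y).adjugate i j) z := by
    simp only [Matrix.adjugate_apply]
    refine contDiffAt_det fun a b => ?_
    by_cases hab : a = j
    · subst hab
      simpa using contDiffAt_const
    · simpa [Matrix.updateRow_ne hab] using h a b
  have h3 := ((contDiffAt_det h).inv hdet).mul h2
  simpa [Matrix.inv_def, Ring.inverse_eq_inv] using h3

/-- Jacobi's formula. -/
theorem fderiv_det {G : E → Matrix ι ι ℂ} {z : E}
    (h : ∀ i j, DifferentiableAt ℝ (fun y => G y i j) z) (e : E) :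
    fderiv ℝ (fun y => (G y).det) z e =
      ((G z).adjugate * Matrix.of fun i j => fderiv ℝ (fun y => G y i j) z e).trace := by
  have h1 : HasFDerivAt (fun y => (G y).det)
      (∑ σ : Equiv.Perm ι, Equiv.Perm.sign σ • ∑ i, (∏ j ∈ Finset.univ.erase i, G z (σ j) j) •
        fderiv ℝ (fun y => G y (σ i) i) z) z := by
    simp only [Matrix.det_apply]
    refine HasFDerivAt.fun_sum fun σ _ => ?_
    exact (HasFDerivAt.finsetProd fun i _ => (h (σ i) i).hasFDerivAt).const_smul (R := ℤˣ) _
  rw [h1.fderiv]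
  set Y : Matrix ι ι ℂ := Matrix.of fun i j => fderiv ℝ (fun y => G y i j) z e with hY
  -- Cramer's rule: the diagonal entries of adj(G) Y are the determinants of G with one column
  -- replaced by that of Y.
  have h2 : ((G z).adjugate * Y).trace = ∑ i, ((G z).updateCol i fun a => Y a i).det := by
    rw [Matrix.trace]
    refine Finset.sum_congr rfl fun i _ => ?_
    rw [← Matrix.cramer_apply, Matrix.cramer_eq_adjugate_mulVec]
    rfl
  rw [h2]
  simp only [Matrix.det_apply]
  rw [Finset.sum_comm]
  simp only [sum_apply, smul_apply]
  refine Finset.sum_congr rfl fun σ _ => ?_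
  rw [← Finset.smul_sum]
  congr 1
  refine Finset.sum_congr rfl fun i _ => ?_
  rw [← Finset.mul_prod_erase _ _ (Finset.mem_univ i)]
  simp only [Matrix.updateCol_self, smul_eq_mul, hY, Matrix.of_apply]
  rw [mul_comm]
  congr 1
  refine Finset.prod_congr rfl fun j hj => ?_
  rw [Matrix.updateCol_ne (Finset.ne_of_mem_erase hj)]

theorem fderiv_log_det {G : E → Matrix ι ι ℂ} {z : E}
    (h : ∀ i j, DifferentiableAt ℝ (fun y => G y i j) z) (hdet : (G z).det ∈ Complex.slitPlane)
    (hd : DifferentiableAt ℝ (fun y => (G y).det) z) (e : E) :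
    fderiv ℝ (fun y => Complex.log (G y).det) z e =
      ∑ i, ∑ j, (G z)⁻¹ j i * fderiv ℝ (fun y => G y i j) z e := by
  have hl := (Complex.hasStrictFDerivAt_log_real hdet).hasFDerivAt.comp z hd.hasFDerivAt
  have hl' : fderiv ℝ (fun y => Complex.log (G y).det) z e =
      (G z).det⁻¹ * fderiv ℝ (fun y => (G y).det) z e := by
    rw [← smul_eq_mul]
    exact DFunLike.congr_fun hl.fderiv e
  rw [hl', fderiv_det h, Matrix.inv_def, Ring.inverse_eq_inv, Finset.sum_comm]
  simp [Matrix.trace, Matrix.mul_apply, Finset.mul_sum, mul_assoc]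

theorem fderiv_inv_apply {G : E → Matrix ι ι ℂ} {z : E}
    (h : ∀ i j, ContDiffAt ℝ 1 (fun y => G y i j) z) (hdet : (G z).det ≠ 0) (e : E) (i j : ι) :
    fderiv ℝ (fun y => (G y)⁻¹ i j) z e =
      -∑ p, ∑ q, (G z)⁻¹ i p * fderiv ℝ (fun y => G y p q) z e * (G z)⁻¹ q j := by
  set X : Matrix ι ι ℂ := Matrix.of fun i j => fderiv ℝ (fun y => (G y)⁻¹ i j) z e with hX
  set Y : Matrix ι ι ℂ := Matrix.of fun i j => fderiv ℝ (fun y => G y i j) z e with hY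
  have hI := contDiffAt_inv_apply h hdet
  have hu : IsUnit (G z).det := isUnit_iff_ne_zero.2 hdet
  -- This is the derivative of the identity G⁻¹ G = 1, valid near z.
  have key : X * G z + (G z)⁻¹ * Y = 0 := by
    ext a b
    have hev : (fun y => ∑ c, (G y)⁻¹ a c * G y c b) =ᶠ[𝓝 z]
        fun _ => (1 : Matrix ι ι ℂ) a b := by
      have : ∀ᶠ y in 𝓝 z, (G y).det ≠ 0 :=
        (contDiffAt_det h).continuousAt.eventually_ne hdet
      filter_upwards [this] with y hy
      rw [← Matrix.mul_apply, Matrix.nonsing_inv_mul _ (isUnit_iff_ne_zero.2 hy)]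
    have h1 := hev.fderiv_eq (𝕜 := ℝ)
    rw [fderiv_const_apply, fderiv_fun_sum (fun c _ =>
      ((hI a c).differentiableAt one_ne_zero).fun_mul ((h c b).differentiableAt one_ne_zero))] at h1
    have h2 := DFunLike.congr_fun h1 e
    simp only [sum_apply, zero_apply] at h2
    rw [Matrix.add_apply, Matrix.mul_apply, Matrix.mul_apply, ← Finset.sum_add_distrib,
      Matrix.zero_apply, ← h2]
    refine Finset.sum_congr rfl fun c _ => ?_
    rw [fderiv_fun_mul ((hI a c).differentiableAt one_ne_zero)
      ((h c b).differentiableAt one_ne_zero)]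
    simp only [hX, hY, Matrix.of_apply, add_apply,
      smul_apply, smul_eq_mul]
    ring
  have h3 : X = -((G z)⁻¹ * Y * (G z)⁻¹) := by
    have h4 : X * G z = -((G z)⁻¹ * Y) := eq_neg_of_add_eq_zero_left key
    calc X = X * G z * (G z)⁻¹ := by rw [Matrix.mul_assoc, Matrix.mul_nonsing_inv _ hu, mul_one]
      _ = _ := by rw [h4, Matrix.neg_mul]
  have h5 : X i j = fderiv ℝ (fun y => (G y)⁻¹ i j) z e := rfl
  rw [← h5, h3, Matrix.neg_apply, Matrix.mul_apply, Finset.sum_comm]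
  simp [Matrix.mul_apply, Finset.sum_mul, hY]

end Determinant

/-! ### Wirtinger calculus and the Ricci tensor -/

section Wirtinger

variable {n : ℕ}

theorem differentiableAt_fderiv_apply {E F : Type*} [NormedAddCommGroup E] [NormedSpace ℝ E]
    [NormedAddCommGroup F] [NormedSpace ℝ F] {f : E → F} {z : E} (hf : ContDiffAt ℝ 2 f z) (e : E) :
    DifferentiableAt ℝ (fun y => fderiv ℝ f y e) z :=
  ((hf.fderiv_right (m := 1) le_rfl).differentiableAt one_ne_zero).clm_apply
    (differentiableAt_const e)

theorem dzbar_differentiableAt {f : Cn n → ℂ} {z : Cn n} (hf : ContDiffAt ℝ 2 f z) (l : Fin n) :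
    DifferentiableAt ℝ (dzbar l f) z := by
  unfold dzbar
  exact ((differentiableAt_fderiv_apply hf _).add
    ((differentiableAt_fderiv_apply hf _).const_mul _)).const_mul _

theorem dz_congr {f h : Cn n → ℂ} {z : Cn n} (e : f =ᶠ[𝓝 z] h) (k : Fin n) :
    dz k f z = dz k h z := by
  simp only [dz, e.fderiv_eq]

theorem dz_fun_sum {ι : Type*} (s : Finset ι) {f : ι → Cn n → ℂ} {z : Cn n}
    (hf : ∀ i ∈ s, DifferentiableAt ℝ (f i) z) (k : Fin n) :
    dz k (fun y => ∑ i ∈ s, f i y) z = ∑ i ∈ s, dz k (f i) z := by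
  simp only [dz, fderiv_fun_sum hf, sum_apply, Finset.mul_sum,
    ← Finset.sum_sub_distrib]

theorem dz_mul {f h : Cn n → ℂ} {z : Cn n}
    (hf : DifferentiableAt ℝ f z) (hh : DifferentiableAt ℝ h z) (k : Fin n) :
    dz k (fun y => f y * h y) z = dz k f z * h z + f z * dz k h z := by
  simp only [dz, fderiv_fun_mul hf hh, add_apply,
    smul_apply, smul_eq_mul]
  ring

/-- The Ricci tensor is `-∂∂̄ log det`. -/
theorem ricci_eq_neg_ddbar_log_det {G : Cn n → Matrix (Fin n) (Fin n) ℂ} {z : Cn n}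
    (h : ∀ i j, ContDiffAt ℝ 2 (fun y => G y i j) z) (hdet : (G z).det ∈ Complex.slitPlane)
    (k l : Fin n) :
    ricci G z k l = -dz k (dzbar l fun y => Complex.log (G y).det) z := by
  have hD : ContDiffAt ℝ 2 (fun y => (G y).det) z := contDiffAt_det h
  have hne : (G z).det ≠ 0 := Complex.slitPlane_ne_zero hdet
  have hev : dzbar l (fun y => Complex.log (G y).det) =ᶠ[𝓝 z]
      fun y => ∑ i, ∑ j, (G y)⁻¹ j i * dzbar l (fun y => G y i j) y := by
    have h1 : ∀ᶠ y in 𝓝 z, (G y).det ∈ Complex.slitPlane :=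
      hD.continuousAt.eventually_mem (Complex.isOpen_slitPlane.mem_nhds hdet)
    have h2 : ∀ᶠ y in 𝓝 z, ∀ i j, ContDiffAt ℝ 2 (fun y => G y i j) y := by
      rw [eventually_all]; intro i
      rw [eventually_all]; intro j
      exact (h i j).eventually (by simp)
    filter_upwards [h1, h2] with y hy1 hy2
    have h3 := fderiv_log_det (fun i j => (hy2 i j).differentiableAt two_ne_zero) hy1
      ((contDiffAt_det hy2).differentiableAt two_ne_zero)
    simp only [dzbar, h3, Finset.mul_sum, ← Finset.sum_add_distrib]
    refine Finset.sum_congr rfl fun i _ => Finset.sum_congr rfl fun j _ => ?_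
    ring
  have hI : ∀ i j, DifferentiableAt ℝ (fun y => (G y)⁻¹ i j) z := fun i j =>
    (contDiffAt_inv_apply h hne i j).differentiableAt two_ne_zero
  have hB : ∀ i j, DifferentiableAt ℝ (dzbar l fun y => G y i j) z := fun i j =>
    dzbar_differentiableAt (h i j) l
  have hdI : ∀ i j, dz k (fun y => (G y)⁻¹ i j) z =
      -∑ p, ∑ q, (G z)⁻¹ i p * dz k (fun y => G y p q) z * (G z)⁻¹ q j := by
    intro i j
    simp only [dz, fderiv_inv_apply (fun i j => (h i j).of_le one_le_two) hne]
    simp only [mul_neg, Finset.mul_sum, ← Finset.sum_neg_distrib, ← Finset.sum_sub_distrib]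
    refine Finset.sum_congr rfl fun p _ => Finset.sum_congr rfl fun q _ => ?_
    ring
  rw [dz_congr hev, dz_fun_sum _ fun i _ => DifferentiableAt.fun_sum fun j _ =>
    (hI j i).fun_mul (hB i j)]
  have h4 : ∀ i, dz k (fun y => ∑ j, (G y)⁻¹ j i * dzbar l (fun y => G y i j) y) z =
      ∑ j, (dz k (fun y => (G y)⁻¹ j i) z * dzbar l (fun y => G y i j) z +
        (G z)⁻¹ j i * dz k (dzbar l (fun y => G y i j)) z) := fun i => by
    rw [dz_fun_sum _ fun j _ => (hI j i).fun_mul (hB i j)]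
    exact Finset.sum_congr rfl fun j _ => dz_mul (hI j i) (hB i j) k
  simp only [h4, hdI, ricci, curvature, upper, mul_add, Finset.sum_add_distrib, neg_add,
    Finset.mul_sum, Finset.sum_mul, neg_mul, mul_neg, Finset.sum_neg_distrib, neg_neg]
  rw [add_comm]
  congr 1
  -- Differentiating G⁻¹ gives the quadratic term of the curvature; only the order of the four
  -- summations differs.
  calc _ = ∑ i, ∑ p, ∑ q, ∑ j, (G z)⁻¹ j i * ((G z)⁻¹ q p * dz k (fun y => G y i q) z *
          dzbar l (fun y => G y p j) z) := by
        refine Finset.sum_congr rfl fun i _ => ?_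
        rw [Finset.sum_comm]
        exact Finset.sum_congr rfl fun p _ => Finset.sum_comm
    _ = ∑ p, ∑ i, ∑ q, ∑ j, (G z)⁻¹ j i * ((G z)⁻¹ q p * dz k (fun y => G y i q) z *
          dzbar l (fun y => G y p j) z) := Finset.sum_comm
    _ = _ := by
        refine Finset.sum_congr rfl fun p _ => ?_
        calc _ = ∑ i, ∑ j, ∑ q, (G z)⁻¹ j i * ((G z)⁻¹ q p * dz k (fun y => G y i q) z *
              dzbar l (fun y => G y p j) z) :=
              Finset.sum_congr rfl fun i _ => Finset.sum_comm
          _ = ∑ j, ∑ i, ∑ q, (G z)⁻¹ j i * ((G z)⁻¹ q p * dz k (fun y => G y i q) z *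
              dzbar l (fun y => G y p j) z) := Finset.sum_comm
          _ = _ := by
            refine Finset.sum_congr rfl fun j _ => Finset.sum_congr rfl fun i _ =>
              Finset.sum_congr rfl fun q _ => ?_
            ring

end Wirtinger

end KahlerFlow

noncomputable section

namespace KahlerFlow

/-! ### The Levi form and the second derivative test -/

section Levi

variable {n : ℕ}

/-- Four times the value of the form `∂∂̄f` on the vector `v`, for real-valued `f`. -/
def levi (f : Cn n → ℝ) (z v : Cn n) : ℝ :=
  fderiv ℝ (fderiv ℝ f) z v v +
    fderiv ℝ (fderiv ℝ f) z (Complex.I • v) (Complex.I • v)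

theorem smul_eq_re_add_im (c : ℂ) (u : Cn n) : c • u = c.re • u + c.im • (Complex.I • u) := by
  ext i
  simp only [PiLp.smul_apply, PiLp.add_apply, smul_eq_mul, Complex.real_smul]
  nth_rw 1 [← Complex.re_add_im c]
  ring

theorem sum_smul_stdVec (v : Cn n) : ∑ k, v k • stdVec n k = v := by
  ext i
  simp [stdVec, Pi.single_apply]

/-- The sesquilinear part of a real bilinear form. -/
def sesqPart (B : Cn n →L[ℝ] Cn n →L[ℝ] ℂ) : Cn n →ₗ[ℂ] Cn n →ₗ⋆[ℂ] ℂ :=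
  LinearMap.mk₂'ₛₗ (RingHom.id ℂ) (starRingEnd ℂ)
    (fun u w => B u w + B (Complex.I • u) (Complex.I • w) + Complex.I * B u (Complex.I • w) -
      Complex.I * B (Complex.I • u) w)
    (fun u u' w => by simp only [smul_add, map_add, add_apply]; ring)
    (fun c u w => by
      rw [smul_comm Complex.I c u, smul_eq_re_add_im c u, smul_eq_re_add_im c (Complex.I • u),
        smul_smul Complex.I Complex.I u, Complex.I_mul_I]
      simp only [neg_smul, one_smul, smul_neg, map_add, map_neg, map_smul, add_apply, neg_apply,
        smul_apply, Complex.real_smul, smul_eq_mul, RingHom.id_apply]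
      nth_rw 9 [← Complex.re_add_im c]
      linear_combination (-(c.im : ℂ) * B u (Complex.I • w) + c.im * B (Complex.I • u) w) *
        Complex.I_sq)
    (fun u w w' => by simp only [smul_add, map_add]; ring)
    (fun c u w => by
      have hc : (starRingEnd ℂ) c = c.re - c.im * Complex.I := by
        apply Complex.ext <;> simp
      rw [smul_comm Complex.I c w, smul_eq_re_add_im c w, smul_eq_re_add_im c (Complex.I • w),
        smul_smul Complex.I Complex.I w, Complex.I_mul_I]
      simp only [neg_smul, one_smul, smul_neg, map_add, map_neg, map_smul,
        Complex.real_smul, smul_eq_mul, hc]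
      linear_combination (c.im * B u (Complex.I • w) - c.im * B (Complex.I • u) w) *
        Complex.I_sq)

theorem sesqPart_apply (B : Cn n →L[ℝ] Cn n →L[ℝ] ℂ) (u w : Cn n) :
    sesqPart B u w = B u w + B (Complex.I • u) (Complex.I • w) +
      Complex.I * B u (Complex.I • w) - Complex.I * B (Complex.I • u) w := rfl

theorem sesq_expand (S : Cn n →ₗ[ℂ] Cn n →ₗ⋆[ℂ] ℂ) (v : Cn n) :
    S v v = ∑ k, ∑ l, v k * (starRingEnd ℂ) (v l) * S (stdVec n k) (stdVec n l) := by
  nth_rw 1 2 [← sum_smul_stdVec v]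
  simp only [map_sum, LinearMap.sum_apply, LinearMap.map_smulₛₗ, LinearMap.smul_apply,
    smul_eq_mul, RingHom.id_apply, Finset.mul_sum]
  rw [Finset.sum_comm]
  refine Finset.sum_congr rfl fun k _ => Finset.sum_congr rfl fun l _ => ?_
  ring

theorem dz_dzbar_eq {f : Cn n → ℂ} {z : Cn n} (hf : ContDiffAt ℝ 2 f z) (k l : Fin n) :
    dz k (dzbar l f) z =
      (1 / 4) * sesqPart (fderiv ℝ (fderiv ℝ f) z) (stdVec n k) (stdVec n l) := by
  have hd : DifferentiableAt ℝ (fderiv ℝ f) z :=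
    (hf.fderiv_right (m := 1) le_rfl).differentiableAt one_ne_zero
  have h1 : ∀ e u, fderiv ℝ (fun y => fderiv ℝ f y e) z u = fderiv ℝ (fderiv ℝ f) z u e := by
    intro e u
    have := (hd.hasFDerivAt.clm_apply (hasFDerivAt_const e z)).fderiv
    rw [this]; simp
  have h2 : ∀ u, fderiv ℝ (dzbar l f) z u = (1 / 2) * (fderiv ℝ (fderiv ℝ f) z u (stdVec n l) +
      Complex.I * fderiv ℝ (fderiv ℝ f) z u (Complex.I • stdVec n l)) := by
    intro u
    have hd1 := differentiableAt_fderiv_apply hf (stdVec n l)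
    have hd2 := differentiableAt_fderiv_apply hf (Complex.I • stdVec n l)
    unfold dzbar
    rw [fderiv_const_mul (hd1.fun_add (hd2.const_mul _)),
      fderiv_fun_add hd1 (hd2.const_mul _), fderiv_const_mul hd2]
    simp only [smul_apply, add_apply, h1, smul_eq_mul]
  rw [dz, h2, h2, sesqPart_apply]
  linear_combination (-(1 / 4) * (fderiv ℝ (fderiv ℝ f) z (Complex.I • stdVec n k)
    (Complex.I • stdVec n l))) * Complex.I_sq

/-- The matrix ∂ₖ∂_{l̄} f consists of the values of `sesqPart` of the Hessian on the standard basis,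
so sesquilinearity evaluates the sum. On the diagonal the two mixed terms cancel by symmetry of the
second derivative. -/
theorem sum_dz_dzbar {f : Cn n → ℂ} {z : Cn n} (hf : ContDiffAt ℝ 2 f z) (v : Cn n) :
    ∑ k, ∑ l, v k * (starRingEnd ℂ) (v l) * dz k (dzbar l f) z =
      (1 / 4) * (fderiv ℝ (fderiv ℝ f) z v v +
        fderiv ℝ (fderiv ℝ f) z (Complex.I • v) (Complex.I • v)) := by
  have hs : IsSymmSndFDerivAt ℝ f z := hf.isSymmSndFDerivAt (by simp)
  have h1 : sesqPart (fderiv ℝ (fderiv ℝ f) z) v v = fderiv ℝ (fderiv ℝ f) z v v +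
        fderiv ℝ (fderiv ℝ f) z (Complex.I • v) (Complex.I • v) := by
    rw [sesqPart_apply, hs.eq v (Complex.I • v)]
    ring
  rw [← h1, sesq_expand, Finset.mul_sum]
  refine Finset.sum_congr rfl fun k _ => ?_
  rw [Finset.mul_sum]
  refine Finset.sum_congr rfl fun l _ => ?_
  rw [dz_dzbar_eq hf]
  ring

theorem fderiv_ofReal {f : Cn n → ℝ} {z : Cn n} (hf : DifferentiableAt ℝ f z) :
    fderiv ℝ (fun y => (f y : ℂ)) z = Complex.ofRealCLM.comp (fderiv ℝ f z) :=
  (Complex.ofRealCLM.hasFDerivAt.comp z hf.hasFDerivAt).fderiv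

theorem fderiv_fderiv_ofReal {f : Cn n → ℝ} {z : Cn n} (hf : ContDiffAt ℝ 2 f z) (u w : Cn n) :
    fderiv ℝ (fderiv ℝ fun y => (f y : ℂ)) z u w = (fderiv ℝ (fderiv ℝ f) z u w : ℝ) := by
  have hev : fderiv ℝ (fun y => (f y : ℂ)) =ᶠ[𝓝 z]
      fun y => Complex.ofRealCLM.comp (fderiv ℝ f y) := by
    filter_upwards [hf.eventually (by simp)] with y hy
    exact fderiv_ofReal (hy.differentiableAt two_ne_zero)
  have hd : DifferentiableAt ℝ (fderiv ℝ f) z :=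
    (hf.fderiv_right (m := 1) le_rfl).differentiableAt one_ne_zero
  rw [hev.fderiv_eq, ((hasFDerivAt_const Complex.ofRealCLM z).clm_comp hd.hasFDerivAt).fderiv]
  simp

theorem contDiffAt_ofReal {f : Cn n → ℝ} {z : Cn n} {k : WithTop ℕ∞} (hf : ContDiffAt ℝ k f z) :
    ContDiffAt ℝ k (fun y => (f y : ℂ)) z :=
  Complex.ofRealCLM.contDiff.contDiffAt.comp z hf

theorem sum_ddbar_eq_levi {f : Cn n → ℝ} {z : Cn n} (hf : ContDiffAt ℝ 2 f z) (v : Cn n) :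
    ∑ k, ∑ l, v k * (starRingEnd ℂ) (v l) * dz k (dzbar l fun y => (f y : ℂ)) z =
      ((levi f z v / 4 : ℝ) : ℂ) := by
  rw [sum_dz_dzbar (contDiffAt_ofReal hf), fderiv_fderiv_ofReal hf, fderiv_fderiv_ofReal hf, levi]
  push_cast
  ring

theorem dzbar_ofReal {f : Cn n → ℝ} {z : Cn n} (hf : DifferentiableAt ℝ f z) (j : Fin n) :
    dzbar j (fun y => (f y : ℂ)) z = (starRingEnd ℂ) (dz j (fun y => (f y : ℂ)) z) := by
  simp [dz, dzbar, fderiv_ofReal hf, Complex.conj_ofNat]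

theorem ddbar_ofReal_conj {f : Cn n → ℝ} {z : Cn n} (hf : ContDiffAt ℝ 2 f z) (k l : Fin n) :
    (starRingEnd ℂ) (dz k (dzbar l fun y => (f y : ℂ)) z) =
      dz l (dzbar k fun y => (f y : ℂ)) z := by
  have hs : IsSymmSndFDerivAt ℝ f z := hf.isSymmSndFDerivAt (by simp)
  rw [dz_dzbar_eq (contDiffAt_ofReal hf), dz_dzbar_eq (contDiffAt_ofReal hf)]
  simp only [sesqPart_apply, fderiv_fderiv_ofReal hf]
  rw [hs.eq (stdVec n l) (stdVec n k), hs.eq (Complex.I • stdVec n l) (Complex.I • stdVec n k),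
    hs.eq (Complex.I • stdVec n l) (stdVec n k), hs.eq (stdVec n l) (Complex.I • stdVec n k)]
  simp only [map_mul, map_add, map_sub, Complex.conj_ofReal, Complex.conj_I, map_div₀, map_one,
    Complex.conj_ofNat]
  ring

/-- The sum is half of the complex linear form u ↦ D u - i D(iu), where D is the real differential,
and its real and imaginary parts are visible. -/
theorem normSq_sum_dz {f : Cn n → ℝ} {z : Cn n} (hf : DifferentiableAt ℝ f z) (v : Cn n) :
    Complex.normSq (∑ i, v i * dz i (fun y => (f y : ℂ)) z) =
      (fderiv ℝ f z v ^ 2 + fderiv ℝ f z (Complex.I • v) ^ 2) / 4 := by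
  let D := fderiv ℝ f z
  let S : Cn n →ₗ[ℂ] ℂ :=
    { toFun := fun u => (D u : ℂ) - Complex.I * (D (Complex.I • u) : ℂ)
      map_add' := fun u w => by simp only [smul_add, map_add, Complex.ofReal_add]; ring
      map_smul' := fun c u => by
        rw [smul_comm Complex.I c u, smul_eq_re_add_im c u, smul_eq_re_add_im c (Complex.I • u),
          smul_smul Complex.I Complex.I u, Complex.I_mul_I]
        simp only [neg_smul, one_smul, smul_neg, map_add, map_neg, map_smul, smul_eq_mul,
          RingHom.id_apply, Complex.ofReal_add, Complex.ofReal_neg, Complex.ofReal_mul]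
        nth_rw 5 [← Complex.re_add_im c]
        linear_combination ((c.im : ℂ) * D (Complex.I • u)) * Complex.I_sq }
  have h1 : ∑ i, v i * dz i (fun y => (f y : ℂ)) z = (1 / 2) * S v := by
    conv_rhs => rw [← sum_smul_stdVec v]
    rw [map_sum, Finset.mul_sum]
    refine Finset.sum_congr rfl fun i _ => ?_
    rw [map_smul, dz, fderiv_ofReal hf, smul_eq_mul]
    simp only [ContinuousLinearMap.comp_apply, Complex.ofRealCLM_apply]
    change _ = 1 / 2 * (v i * ((D _ : ℂ) - Complex.I * (D _ : ℂ)))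
    ring
  rw [h1, map_mul]
  change _ * Complex.normSq ((D v : ℂ) - Complex.I * (D (Complex.I • v) : ℂ)) = _
  simp only [Complex.normSq_apply]
  simp
  change _ = (D v ^ 2 + D (Complex.I • v) ^ 2) / 4
  ring

theorem levi_comp {f : Cn n → ℝ} {z : Cn n} (hf : ContDiffAt ℝ 2 f z) {φ φ' : ℝ → ℝ} {φ'' : ℝ}
    (h1 : ∀ᶠ y in 𝓝 (f z), HasDerivAt φ (φ' y) y) (h2 : HasDerivAt φ' φ'' (f z)) (v : Cn n) :
    levi (fun y => φ (f y)) z v = φ' (f z) * levi f z v +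
      φ'' * (fderiv ℝ f z v ^ 2 + fderiv ℝ f z (Complex.I • v) ^ 2) := by
  have hev : fderiv ℝ (fun y => φ (f y)) =ᶠ[𝓝 z] fun y => φ' (f y) • fderiv ℝ f y := by
    filter_upwards [hf.eventually (by simp), hf.continuousAt.eventually h1] with y hy hy1
    exact (hy1.comp_hasFDerivAt y (hy.differentiableAt two_ne_zero).hasFDerivAt).fderiv
  have hd : DifferentiableAt ℝ (fderiv ℝ f) z :=
    (hf.fderiv_right (m := 1) le_rfl).differentiableAt one_ne_zero
  have h3 := (h2.comp_hasFDerivAt z (hf.differentiableAt two_ne_zero).hasFDerivAt).fun_smul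
    hd.hasFDerivAt
  simp only [levi, hev.fderiv_eq]
  have h4 : ∀ u w, fderiv ℝ (fun y => φ' (f y) • fderiv ℝ f y) z u w =
      φ' (f z) * fderiv ℝ (fderiv ℝ f) z u w + φ'' * fderiv ℝ f z u * fderiv ℝ f z w := by
    intro u w
    refine (congrArg (fun L => L u w) h3.fderiv).trans ?_
    simp
  rw [h4, h4]
  ring

theorem levi_congr {f h : Cn n → ℝ} {z : Cn n} (e : f =ᶠ[𝓝 z] h) (v : Cn n) :
    levi f z v = levi h z v := by
  simp only [levi, e.fderiv.fderiv_eq]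

/-- The function `f` is twice differentiable at `z`. -/
def TwiceDifferentiableAt {E : Type*} [NormedAddCommGroup E] [NormedSpace ℝ E] (f : E → ℝ)
    (z : E) : Prop :=
  (∀ᶠ y in 𝓝 z, DifferentiableAt ℝ f y) ∧ DifferentiableAt ℝ (fderiv ℝ f) z

/-- The weaker notion is enough for the second derivative test, and it is what differentiation under
the integral sign yields for the potential. -/
theorem _root_.ContDiffAt.twiceDifferentiableAt {E : Type*} [NormedAddCommGroup E]
    [NormedSpace ℝ E] {f : E → ℝ} {z : E} (hf : ContDiffAt ℝ 2 f z) : TwiceDifferentiableAt f z :=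
  ⟨(hf.eventually (by simp)).mono fun _ hy => hy.differentiableAt two_ne_zero,
    (hf.fderiv_right (m := 1) le_rfl).differentiableAt one_ne_zero⟩

theorem TwiceDifferentiableAt.sub {E : Type*} [NormedAddCommGroup E]
    [NormedSpace ℝ E] {f h : E → ℝ} {z : E} (hf : TwiceDifferentiableAt f z)
    (hh : TwiceDifferentiableAt h z) : TwiceDifferentiableAt (fun y => f y - h y) z := by
  refine ⟨by filter_upwards [hf.1, hh.1] with y h1 h2 using h1.sub h2,
    (hf.2.sub hh.2).congr_of_eventuallyEq ?_⟩
  filter_upwards [hf.1, hh.1] with y hy1 hy2 using fderiv_fun_sub hy1 hy2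

theorem levi_sub {f h : Cn n → ℝ} {z : Cn n} (hf : TwiceDifferentiableAt f z)
    (hh : TwiceDifferentiableAt h z) (v : Cn n) :
    levi (fun y => f y - h y) z v = levi f z v - levi h z v := by
  have hev : fderiv ℝ (fun y => f y - h y) =ᶠ[𝓝 z] fun y => fderiv ℝ f y - fderiv ℝ h y := by
    filter_upwards [hf.1, hh.1] with y hy1 hy2 using fderiv_fun_sub hy1 hy2
  simp only [levi, hev.fderiv_eq, fderiv_fun_sub hf.2 hh.2, sub_apply]
  ring

/-- The second derivative test. -/
theorem fderiv_fderiv_nonpos_of_isLocalMax {E : Type*} [NormedAddCommGroup E] [NormedSpace ℝ E]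
    {f : E → ℝ} {z : E} (hf : TwiceDifferentiableAt f z) (hm : IsLocalMax f z) (v : E) :
    fderiv ℝ (fderiv ℝ f) z v v ≤ 0 := by
  obtain ⟨hd1, hd2⟩ := hf
  have hc : ContinuousAt (fun t : ℝ => z + t • v) 0 := by fun_prop
  have hz : z + (0 : ℝ) • v = z := by simp
  have hl : ∀ t : ℝ, HasDerivAt (fun t : ℝ => z + t • v) v t := fun t => by
    simpa using ((hasDerivAt_id t).smul_const v).const_add z
  have htend : Tendsto (fun t : ℝ => z + t • v) (𝓝 0) (𝓝 z) := by
    simpa [ContinuousAt] using hc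
  set p : ℝ → ℝ := fun t => f (z + t • v) with hp
  have hp1 : deriv p =ᶠ[𝓝 0] fun t => fderiv ℝ f (z + t • v) v := by
    filter_upwards [htend.eventually hd1] with t ht
    exact (ht.hasFDerivAt.comp_hasDerivAt t (hl t)).deriv
  have hp2 : HasDerivAt (deriv p) (fderiv ℝ (fderiv ℝ f) z v v) 0 := by
    have h2 : HasDerivAt (fun t : ℝ => fderiv ℝ f (z + t • v)) (fderiv ℝ (fderiv ℝ f) z v) 0 := by
      have := hd2.hasFDerivAt
      rw [← hz] at this
      have h3 := this.comp_hasDerivAt 0 (hl 0)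
      simp only [zero_smul, add_zero] at h3
      exact h3
    have h3 := h2.clm_apply (hasDerivAt_const (0 : ℝ) v)
    simp only [map_zero, add_zero] at h3
    exact h3.congr_of_eventuallyEq hp1
  have hmax : IsLocalMax p 0 := by
    have : ∀ᶠ t in 𝓝 (0 : ℝ), f (z + t • v) ≤ f z := htend.eventually hm
    simpa [IsLocalMax, IsMaxFilter, hp] using this
  have hpc : ContinuousAt p 0 := by
    have : ContinuousAt f (z + (0 : ℝ) • v) := by
      rw [hz]; exact hd1.self_of_nhds.continuousAt
    exact ContinuousAt.comp (f := fun t : ℝ => z + t • v) this hc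
  by_contra hcon
  push Not at hcon
  -- A positive second derivative would make 0 a local minimum as well, so `p` would be locally
  -- constant, with second derivative 0.
  have hmin := isLocalMin_of_deriv_deriv_pos (f := p) (x₀ := 0) (by rw [hp2.deriv]; exact hcon)
    hmax.deriv_eq_zero hpc
  have hconst : p =ᶠ[𝓝 0] fun _ => p 0 := by
    filter_upwards [hmax, hmin] with t h1 h2 using le_antisymm h1 h2
  have h0 : deriv (deriv p) 0 = 0 := by
    rw [hconst.deriv.deriv_eq]; simp
  rw [hp2.deriv] at h0
  linarith

theorem levi_nonpos_of_isLocalMax {f : Cn n → ℝ} {z : Cn n} (hf : TwiceDifferentiableAt f z)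
    (hm : IsLocalMax f z) (v : Cn n) : levi f z v ≤ 0 :=
  add_nonpos (fderiv_fderiv_nonpos_of_isLocalMax hf hm v)
    (fderiv_fderiv_nonpos_of_isLocalMax hf hm _)

end Levi

/-! ### Differentiation under the integral sign -/

section ParametricIntegral

open MeasureTheory

variable {E F : Type*} [NormedAddCommGroup E] [NormedSpace ℝ E] [ProperSpace E]
  [NormedAddCommGroup F] [NormedSpace ℝ F]

/-- The derivative is continuous on the compact product of [a, b] with a small closed ball, hence
bounded there by a constant, which serves as the dominating function. -/
theorem hasFDerivAt_intervalIntegral {a b : ℝ} (hab : a ≤ b) {U : Set E} (hU : IsOpen U)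
    {H : ℝ → E → F} {H' : ℝ → E → E →L[ℝ] F}
    (hd : ∀ s ∈ Icc a b, ∀ z ∈ U, HasFDerivAt (H s) (H' s z) z)
    (hH : ContinuousOn (fun p : ℝ × E => H p.1 p.2) (Icc a b ×ˢ U))
    (hH' : ContinuousOn (fun p : ℝ × E => H' p.1 p.2) (Icc a b ×ˢ U)) {z₀ : E} (hz : z₀ ∈ U) :
    HasFDerivAt (fun z => ∫ s in a..b, H s z) (∫ s in a..b, H' s z₀) z₀ := by
  obtain ⟨r, hr, hrU⟩ := Metric.nhds_basis_closedBall.mem_iff.1 (hU.mem_nhds hz)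
  have hK : IsCompact (Icc a b ×ˢ Metric.closedBall z₀ r) :=
    isCompact_Icc.prod (isCompact_closedBall z₀ r)
  obtain ⟨C, hC⟩ := hK.exists_bound_of_continuousOn
    (hH'.mono (prod_mono_right hrU))
  have hslice : ∀ z ∈ U, ContinuousOn (fun s => H s z) (Icc a b) := fun z hz =>
    hH.comp (f := fun s => (s, z)) (by fun_prop) fun s hs => ⟨hs, hz⟩
  have hslice' : ContinuousOn (fun s => H' s z₀) (Icc a b) :=
    hH'.comp (f := fun s => (s, z₀)) (by fun_prop) fun s hs => ⟨hs, hz⟩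
  have hsub : Set.uIoc a b ⊆ Icc a b := by
    rw [uIoc_of_le hab]; exact Ioc_subset_Icc_self
  refine (intervalIntegral.hasFDerivAt_integral_of_dominated_of_fderiv_le
    (F := fun z s => H s z) (F' := fun z s => H' s z) (bound := fun _ => C) (Metric.ball_mem_nhds z₀ hr) ?_ ?_ ?_ ?_ ?_ ?_)
  · filter_upwards [hU.mem_nhds hz] with z hz
    exact ((hslice z hz).mono hsub).aestronglyMeasurable measurableSet_uIoc
  · exact ContinuousOn.intervalIntegrable (by rw [uIcc_of_le hab]; exact hslice z₀ hz)
  · exact (hslice'.mono hsub).aestronglyMeasurable measurableSet_uIoc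
  · exact ae_of_all _ fun s hs z hz => hC (s, z) ⟨hsub hs, Metric.ball_subset_closedBall hz⟩
  · exact intervalIntegrable_const
  · exact ae_of_all _ fun s hs z hz =>
      hd s (hsub hs) z (hrU (Metric.ball_subset_closedBall hz))

end ParametricIntegral

end KahlerFlow

end

noncomputable section

namespace KahlerFlow

/-! ### Inequalities between Hermitian forms -/

section MatrixBounds

open scoped Matrix ComplexOrder

variable {n : ℕ}

/-- The value `∑ G_{i j̄} vᵢ v̄ⱼ` of a Hermitian form on the vector `v`. -/
def quad (G : Matrix (Fin n) (Fin n) ℂ) (v : Cn n) : ℝ :=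
  (∑ i, ∑ j, v i * (starRingEnd ℂ) (v j) * G i j).re

/-- In g_{i j̄} vᵢ v̄ⱼ the second factor is conjugated, in `star w ⬝ᵥ G *ᵥ w` the first; hence w is
the conjugate of v. -/
theorem sum_eq_dotProduct (G : Matrix (Fin n) (Fin n) ℂ) (v : Cn n) :
    ∑ i, ∑ j, v i * (starRingEnd ℂ) (v j) * G i j =
      star (fun i => (starRingEnd ℂ) (v i)) ⬝ᵥ G *ᵥ fun i => (starRingEnd ℂ) (v i) := by
  simp only [dotProduct, Matrix.mulVec, Finset.mul_sum, Pi.star_apply]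
  refine Finset.sum_congr rfl fun i _ => Finset.sum_congr rfl fun j _ => ?_
  simp
  ring

theorem quad_eq_dotProduct (G : Matrix (Fin n) (Fin n) ℂ) (v : Cn n) :
    quad G v =
      (star (fun i => (starRingEnd ℂ) (v i)) ⬝ᵥ G *ᵥ fun i => (starRingEnd ℂ) (v i)).re := by
  rw [quad, sum_eq_dotProduct]

theorem exists_eq_conjTranspose_mul_self {G : Matrix (Fin n) (Fin n) ℂ} (hG : G.PosDef) :
    ∃ P : Matrix (Fin n) (Fin n) ℂ, G = Pᴴ * P ∧ IsUnit P.det := by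
  open scoped MatrixOrder in
  obtain ⟨P, hP⟩ := CStarAlgebra.nonneg_iff_eq_star_mul_self.1 hG.posSemidef.nonneg
  refine ⟨P, hP, ?_⟩
  have h := hG.det_pos.ne'
  rw [hP, Matrix.det_mul] at h
  exact isUnit_iff_ne_zero.2 (right_ne_zero_of_mul h)

/-- When G = P* P, the matrix P⁻* A P⁻¹ represents the form A in a frame that is unitary for G. The
comparisons below reduce to G = 1 in this way. -/
theorem conj_dotProduct_mulVec {P : Matrix (Fin n) (Fin n) ℂ} (hP : IsUnit P.det)
    (A : Matrix (Fin n) (Fin n) ℂ) (w : Fin n → ℂ) :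
    star w ⬝ᵥ A *ᵥ w = star (P *ᵥ w) ⬝ᵥ ((P⁻¹)ᴴ * A * P⁻¹) *ᵥ (P *ᵥ w) := by
  rw [Matrix.star_mulVec, Matrix.mulVec_mulVec, Matrix.mul_assoc, Matrix.nonsing_inv_mul _ hP,
    Matrix.mul_one, ← Matrix.mulVec_mulVec, ← Matrix.dotProduct_mulVec, Matrix.mulVec_mulVec,
    ← Matrix.conjTranspose_mul, Matrix.nonsing_inv_mul _ hP]
  simp

theorem dotProduct_conjTranspose_mul_self (P : Matrix (Fin n) (Fin n) ℂ) (w : Fin n → ℂ) :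
    (star w ⬝ᵥ (Pᴴ * P) *ᵥ w).re = ∑ i, ‖(P *ᵥ w) i‖ ^ 2 := by
  rw [← Matrix.mulVec_mulVec, Matrix.dotProduct_mulVec, ← Matrix.star_mulVec, dotProduct,
    Complex.re_sum]
  refine Finset.sum_congr rfl fun i _ => ?_
  rw [Pi.star_apply, RCLike.star_def, ← Complex.normSq_eq_conj_mul_self, Complex.ofReal_re,
    Complex.normSq_eq_norm_sq]

/-- Cauchy-Schwarz over pairs of indices: the Hilbert-Schmidt norm dominates the operator norm. -/
theorem norm_dotProduct_mulVec_le (A : Matrix (Fin n) (Fin n) ℂ) (u : Fin n → ℂ) :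
    ‖star u ⬝ᵥ A *ᵥ u‖ ≤ √(∑ i, ∑ j, ‖A i j‖ ^ 2) * ∑ i, ‖u i‖ ^ 2 := by
  have h1 : ‖star u ⬝ᵥ A *ᵥ u‖ ≤ ∑ p : Fin n × Fin n, ‖A p.1 p.2‖ * (‖u p.1‖ * ‖u p.2‖) := by
    rw [Fintype.sum_prod_type, dotProduct]
    refine (norm_sum_le _ _).trans (Finset.sum_le_sum fun i _ => ?_)
    rw [norm_mul, Matrix.mulVec, dotProduct]
    refine (mul_le_mul_of_nonneg_left (norm_sum_le _ _) (norm_nonneg _)).trans ?_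
    rw [Finset.mul_sum]
    refine Finset.sum_le_sum fun j _ => le_of_eq ?_
    simp only [Pi.star_apply, norm_star, norm_mul]
    ring
  refine h1.trans ((Real.sum_mul_le_sqrt_mul_sqrt _ _ _).trans (le_of_eq ?_))
  rw [Fintype.sum_prod_type, Fintype.sum_prod_type]
  congr 1
  rw [Real.sqrt_eq_iff_mul_self_eq (by positivity) (by positivity), Finset.sum_mul_sum]
  refine Finset.sum_congr rfl fun i _ => Finset.sum_congr rfl fun j _ => ?_
  ring

/-- A Hermitian form `H` is bounded by its norm with respect to `G`, times `G`. -/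
theorem quad_le_of_normSq_le {G H : Matrix (Fin n) (Fin n) ℂ} (hG : G.PosDef)
    (hH : H.IsHermitian) {C : ℝ}
    (hC : (∑ i, ∑ j, ∑ k, ∑ l, upper G i l * upper G k j * H i j * H k l).re ≤ C) (v : Cn n) :
    quad H v ≤ √C * quad G v := by
  obtain ⟨P, rfl, hP⟩ := exists_eq_conjTranspose_mul_self hG
  set A := (P⁻¹)ᴴ * H * P⁻¹ with hA
  have hAH : Aᴴ = A := by
    simp only [hA, Matrix.conjTranspose_mul, hH.eq, Matrix.conjTranspose_conjTranspose,
      Matrix.mul_assoc]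
  -- In a unitary frame the squared norm of the form is tr A², which equals ∑ |A i j|² because A is
  -- Hermitian.
  have h1 : ∑ i, ∑ j, ∑ k, ∑ l, upper (Pᴴ * P) i l * upper (Pᴴ * P) k j * H i j * H k l =
      (A * A).trace := by
    have h2 : (A * A).trace = ((Pᴴ * P)⁻¹ * H * ((Pᴴ * P)⁻¹ * H)).trace := by
      rw [Matrix.mul_inv_rev, ← Matrix.conjTranspose_nonsing_inv, hA]
      calc _ = ((P⁻¹)ᴴ * H * P⁻¹ * (P⁻¹)ᴴ * H * P⁻¹).trace := by simp only [Matrix.mul_assoc]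
        _ = (P⁻¹ * ((P⁻¹)ᴴ * H * P⁻¹ * (P⁻¹)ᴴ * H)).trace := by rw [Matrix.trace_mul_comm]
        _ = _ := by simp only [Matrix.mul_assoc]
    rw [h2, Matrix.trace]
    set K := (Pᴴ * P)⁻¹ with hK
    simp only [Matrix.diag_apply, Matrix.mul_apply, Finset.sum_mul_sum, upper, ← hK]
    calc _ = ∑ i, ∑ j, ∑ l, ∑ k, K l i * K j k * H i j * H k l :=
          Finset.sum_congr rfl fun i _ => Finset.sum_congr rfl fun j _ => Finset.sum_comm
      _ = ∑ i, ∑ l, ∑ j, ∑ k, K l i * K j k * H i j * H k l :=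
          Finset.sum_congr rfl fun i _ => Finset.sum_comm
      _ = ∑ l, ∑ i, ∑ j, ∑ k, K l i * K j k * H i j * H k l := Finset.sum_comm
      _ = _ := by
        refine Finset.sum_congr rfl fun l _ => ?_
        rw [Finset.sum_comm]
        refine Finset.sum_congr rfl fun j _ => Finset.sum_congr rfl fun i _ =>
          Finset.sum_congr rfl fun k _ => ?_
        ring
  have h3 : (A * A).trace.re = ∑ i, ∑ j, ‖A i j‖ ^ 2 := by
    nth_rw 1 [← hAH]
    rw [Matrix.trace, Complex.re_sum, Finset.sum_comm]
    refine Finset.sum_congr rfl fun i _ => ?_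
    rw [Matrix.diag_apply, Matrix.mul_apply, Complex.re_sum]
    refine Finset.sum_congr rfl fun j _ => ?_
    rw [Matrix.conjTranspose_apply, RCLike.star_def, ← Complex.normSq_eq_conj_mul_self,
      Complex.ofReal_re, Complex.normSq_eq_norm_sq]
  rw [h1, h3] at hC
  rw [quad_eq_dotProduct, quad_eq_dotProduct, conj_dotProduct_mulVec hP,
    dotProduct_conjTranspose_mul_self]
  refine (Complex.re_le_norm _).trans ((norm_dotProduct_mulVec_le _ _).trans ?_)
  exact mul_le_mul_of_nonneg_right (Real.sqrt_le_sqrt hC)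
    (Finset.sum_nonneg fun _ _ => by positivity)

/-- The Cauchy-Schwarz inequality for the metric `G`. -/
theorem normSq_sum_le_of_gradNormSq_le {G : Matrix (Fin n) (Fin n) ℂ} (hG : G.PosDef)
    {a : Fin n → ℂ} {C : ℝ}
    (hC : (∑ i, ∑ j, upper G i j * a i * (starRingEnd ℂ) (a j)).re ≤ C) (v : Cn n) :
    Complex.normSq (∑ i, v i * a i) ≤ C * quad G v := by
  obtain ⟨P, rfl, hP⟩ := exists_eq_conjTranspose_mul_self hG
  set w : Fin n → ℂ := fun i => (starRingEnd ℂ) (v i) with hw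
  have h1 : ∑ i, ∑ j, upper (Pᴴ * P) i j * a i * (starRingEnd ℂ) (a j) =
      star a ⬝ᵥ (((P⁻¹)ᴴ)ᴴ * (P⁻¹)ᴴ) *ᵥ a := by
    rw [Matrix.conjTranspose_conjTranspose, Matrix.conjTranspose_nonsing_inv,
      ← Matrix.mul_inv_rev, Finset.sum_comm]
    simp only [dotProduct, Matrix.mulVec, Finset.mul_sum, Pi.star_apply, upper]
    refine Finset.sum_congr rfl fun i _ => Finset.sum_congr rfl fun j _ => ?_
    simp
    ring
  have h2 : ∑ i, v i * a i = star (P *ᵥ w) ⬝ᵥ (P⁻¹)ᴴ *ᵥ a := by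
    rw [Matrix.star_mulVec, ← Matrix.dotProduct_mulVec, Matrix.mulVec_mulVec,
      ← Matrix.conjTranspose_mul, Matrix.nonsing_inv_mul _ hP]
    simp [dotProduct, hw]
  rw [h1, dotProduct_conjTranspose_mul_self] at hC
  rw [quad_eq_dotProduct, dotProduct_conjTranspose_mul_self, h2, Complex.normSq_eq_norm_sq]
  have h3 : ‖star (P *ᵥ w) ⬝ᵥ (P⁻¹)ᴴ *ᵥ a‖ ≤ ∑ i, ‖((P⁻¹)ᴴ *ᵥ a) i‖ * ‖(P *ᵥ w) i‖ := by
    refine (norm_sum_le _ _).trans (Finset.sum_le_sum fun i _ => le_of_eq ?_)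
    rw [norm_mul, Pi.star_apply, norm_star, mul_comm]
  calc _ ≤ (∑ i, ‖((P⁻¹)ᴴ *ᵥ a) i‖ * ‖(P *ᵥ w) i‖) ^ 2 := by gcongr
    _ ≤ (∑ i, ‖((P⁻¹)ᴴ *ᵥ a) i‖ ^ 2) * ∑ i, ‖(P *ᵥ w) i‖ ^ 2 :=
      Finset.sum_mul_sq_le_sq_mul_sq _ _ _
    _ ≤ _ := mul_le_mul_of_nonneg_right hC (Finset.sum_nonneg fun _ _ => by positivity)

/-- In a frame unitary for G the eigenvalues of H lie in (0, c], and det H / det G is their product.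
-/
theorem det_re_le_of_quad_le {G H : Matrix (Fin n) (Fin n) ℂ} (hG : G.PosDef) (hH : H.PosDef)
    {c : ℝ} (hc : ∀ v, quad H v ≤ c * quad G v) : H.det.re ≤ c ^ n * G.det.re := by
  obtain ⟨P, rfl, hP⟩ := exists_eq_conjTranspose_mul_self hG
  set A := (P⁻¹)ᴴ * H * P⁻¹ with hA
  have hPinv : Function.Injective (P⁻¹).mulVec :=
    Matrix.mulVec_injective_of_isUnit ((Matrix.isUnit_iff_isUnit_det _).2
      (Matrix.isUnit_nonsing_inv_det _ hP))
  have hAp : A.PosDef := hH.conjTranspose_mul_mul_same hPinv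
  have hev : ∀ i, hAp.1.eigenvalues i ≤ c := by
    intro i
    set u : Fin n → ℂ := ⇑(hAp.1.eigenvectorBasis i) with hu
    have h1 := hAp.1.eigenvalues_eq i
    have hun : ∑ j, ‖u j‖ ^ 2 = 1 := by
      have := hAp.1.eigenvectorBasis.orthonormal.1 i
      rw [EuclideanSpace.norm_eq, Real.sqrt_eq_one] at this
      exact this
    let w := P⁻¹ *ᵥ u
    let v : Cn n := WithLp.toLp 2 fun i => (starRingEnd ℂ) (w i)
    have hPw : P *ᵥ w = u := by
      simp [w, Matrix.mulVec_mulVec, Matrix.mul_nonsing_inv _ hP]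
    have h2 := hc v
    have hvw : (fun i => (starRingEnd ℂ) (v i)) = w := by
      funext i; simp [v]
    rw [quad_eq_dotProduct, quad_eq_dotProduct, hvw, dotProduct_conjTranspose_mul_self,
      conj_dotProduct_mulVec hP, hPw, hun, mul_one] at h2
    rw [h1]
    exact h2
  have hdet : (Pᴴ * P).det * A.det = H.det := by
    have h4 : P.det * P⁻¹.det = 1 := by
      rw [← Matrix.det_mul, Matrix.mul_nonsing_inv _ hP, Matrix.det_one]
    have h5 : (Pᴴ).det * ((P⁻¹)ᴴ).det = 1 := by
      rw [mul_comm, ← Matrix.det_mul, ← Matrix.conjTranspose_mul, Matrix.mul_nonsing_inv _ hP]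
      simp
    simp only [hA, Matrix.det_mul]
    linear_combination (H.det * (Pᴴ).det * ((P⁻¹)ᴴ).det) * h4 + H.det * h5
  have hAd : A.det = ((∏ i, hAp.1.eigenvalues i : ℝ) : ℂ) := by
    rw [hAp.1.det_eq_prod_eigenvalues]; push_cast; rfl
  have hprod : ∏ i, hAp.1.eigenvalues i ≤ c ^ n := by
    refine (Finset.prod_le_prod (fun i _ => (hAp.eigenvalues_pos i).le) fun i _ => hev i).trans ?_
    simp
  rw [← hdet, hAd, Complex.re_mul_ofReal, mul_comm]
  exact mul_le_mul_of_nonneg_right hprod (Complex.pos_iff.1 hG.det_pos).1.le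

end MatrixBounds

end KahlerFlow

end

noncomputable section

namespace KahlerFlow

/-! ### Coefficients and determinants of a Hermitian metric -/

section Metric

open scoped Matrix ComplexOrder

variable {n : ℕ} {M : Type*} [TopologicalSpace M] [ChartedSpace (Cn n) M]

namespace HermitianMetric

/-- The Gram matrix of the metric in the frame that is the image under `A` of the standard one. -/
def formMatrix (g : HermitianMetric n M) (x : M) (A : Cn n →ₗ[ℂ] TangentSpace 𝓘(ℂ, Cn n) x) :
    Matrix (Fin n) (Fin n) ℂ :=
  Matrix.of fun i j => g.form x (A (stdVec n j)) (A (stdVec n i))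

theorem form_eq_sum (g : HermitianMetric n M) (x : M)
    (A : Cn n →ₗ[ℂ] TangentSpace 𝓘(ℂ, Cn n) x) (u v : Cn n) :
    g.form x (A u) (A v) = ∑ i, ∑ j, v i * (starRingEnd ℂ) (u j) * g.formMatrix x A i j := by
  nth_rw 1 [← sum_smul_stdVec u, ← sum_smul_stdVec v]
  simp only [map_sum, LinearMap.sum_apply, LinearMap.map_smulₛₗ, LinearMap.smul_apply,
    smul_eq_mul, RingHom.id_apply, Finset.mul_sum, formMatrix, Matrix.of_apply]
  refine Finset.sum_congr rfl fun k _ => Finset.sum_congr rfl fun l _ => ?_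
  ring

theorem quad_formMatrix (g : HermitianMetric n M) (x : M)
    (A : Cn n →ₗ[ℂ] TangentSpace 𝓘(ℂ, Cn n) x) (v : Cn n) :
    quad (g.formMatrix x A) v = g.normSq x (A v) := by
  rw [quad, normSq, form_eq_sum]

theorem form_self_im (g : HermitianMetric n M) (x : M) (v : TangentSpace 𝓘(ℂ, Cn n) x) :
    (g.form x v v).im = 0 :=
  Complex.conj_eq_iff_im.1 (g.conj_symm x v v)

theorem posDef_formMatrix (g : HermitianMetric n M) (x : M)
    {A : Cn n →ₗ[ℂ] TangentSpace 𝓘(ℂ, Cn n) x} (hA : Function.Injective A) :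
    (g.formMatrix x A).PosDef := by
  refine Matrix.posDef_iff_dotProduct_mulVec.2 ⟨?_, fun w hw => ?_⟩
  · ext i j
    exact g.conj_symm x _ _
  · let v : Cn n := WithLp.toLp 2 fun i => (starRingEnd ℂ) (w i)
    have hvw : (fun i => (starRingEnd ℂ) (v i)) = w := by
      funext i; simp [v]
    have hv : v ≠ 0 := by
      rintro h0
      apply hw
      rw [← hvw, h0]
      funext i; simp
    have h1 := sum_eq_dotProduct (g.formMatrix x A) v
    rw [hvw, ← form_eq_sum] at h1
    rw [← h1, Complex.pos_iff]
    exact ⟨g.pos x _ fun h0 => hv (hA (h0.trans (map_zero A).symm)), (g.form_self_im x _).symm⟩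

/-- With J the matrix of A, the Gram matrix changes by Jᵀ on the left and the conjugate of J on the
right. -/
theorem det_formMatrix (g : HermitianMetric n M) (x : M)
    (A : Cn n →ₗ[ℂ] TangentSpace 𝓘(ℂ, Cn n) x) :
    (g.formMatrix x A).det =
      (Matrix.of fun p i => (show Cn n from A (stdVec n i)) p : Matrix (Fin n) (Fin n) ℂ).det *
      (g.formMatrix x (LinearMap.id : Cn n →ₗ[ℂ] Cn n)).det *
      (starRingEnd ℂ) (Matrix.of fun p i => (show Cn n from A (stdVec n i)) p :
        Matrix (Fin n) (Fin n) ℂ).det := by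
  set J : Matrix (Fin n) (Fin n) ℂ := Matrix.of fun p i => (show Cn n from A (stdVec n i)) p
    with hJ
  have h1 : g.formMatrix x A =
      Jᵀ * g.formMatrix x (LinearMap.id : Cn n →ₗ[ℂ] Cn n) * J.map (starRingEnd ℂ) := by
    ext i j
    have := g.form_eq_sum x (LinearMap.id : Cn n →ₗ[ℂ] Cn n) (A (stdVec n j)) (A (stdVec n i))
    refine Eq.trans this ?_
    rw [Matrix.mul_apply, Finset.sum_comm]
    refine Finset.sum_congr rfl fun q _ => ?_
    rw [Matrix.mul_apply, Finset.sum_mul]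
    refine Finset.sum_congr rfl fun p _ => ?_
    simp only [Matrix.transpose_apply, Matrix.map_apply, hJ, Matrix.of_apply]
    ring
  rw [h1, Matrix.det_mul, Matrix.det_mul, Matrix.det_transpose]
  congr 1
  exact (RingHom.map_det (starRingEnd ℂ) J).symm

/-- The logarithm of the determinant of the metric in the standard frame of `TangentSpace`. -/
def logDet (g : HermitianMetric n M) (x : M) : ℝ :=
  Real.log (g.formMatrix x (LinearMap.id : Cn n →ₗ[ℂ] Cn n)).det.re

/-- A change of frame multiplies each determinant by |det J|², which does not depend on the metric
and cancels. So, although `logDet` by itself depends on the frame of the tangent space at each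
point, differences of `logDet` can be computed in any chart. -/
theorem log_det_formMatrix_sub (g h : HermitianMetric n M) (x : M)
    {A : Cn n →ₗ[ℂ] TangentSpace 𝓘(ℂ, Cn n) x} (hA : Function.Injective A) :
    Real.log (h.formMatrix x A).det.re - Real.log (g.formMatrix x A).det.re =
      h.logDet x - g.logDet x := by
  have key : ∀ k : HermitianMetric n M, Real.log (k.formMatrix x A).det.re =
      Real.log (Complex.normSq (Matrix.of fun p i => (show Cn n from A (stdVec n i)) p :
        Matrix (Fin n) (Fin n) ℂ).det) + k.logDet x := by
    intro k
    have h1 := (Complex.pos_iff.1 (k.posDef_formMatrix x hA).det_pos).1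
    have h2 := (Complex.pos_iff.1 (k.posDef_formMatrix x (A := (LinearMap.id : Cn n →ₗ[ℂ] Cn n))
      Function.injective_id).det_pos).1
    rw [det_formMatrix, mul_right_comm, Complex.mul_conj, Complex.re_ofReal_mul] at h1 ⊢
    rw [Real.log_mul _ h2.ne', logDet]
    intro h0
    rw [h0, zero_mul] at h1
    exact lt_irrefl _ h1
  rw [key g, key h]
  ring

theorem coeff_eq_formMatrix (g : HermitianMetric n M) (c : OpenPartialHomeomorph M (Cn n))
    (z : Cn n) : g.coeff c z = g.formMatrix (c.symm z)
      (mfderiv 𝓘(ℂ, Cn n) 𝓘(ℂ, Cn n) c.symm z).toLinearMap := rfl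

theorem quad_coeff (g : HermitianMetric n M) (c : OpenPartialHomeomorph M (Cn n)) (z v : Cn n) :
    quad (g.coeff c z) v =
      g.normSq (c.symm z) (mfderiv 𝓘(ℂ, Cn n) 𝓘(ℂ, Cn n) c.symm z v) :=
  g.quad_formMatrix _ _ v

variable [IsManifold 𝓘(ℂ, Cn n) ω M]

theorem _root_.KahlerFlow.mfderiv_symm_bijective {c : OpenPartialHomeomorph M (Cn n)}
    (hc : c ∈ atlas (Cn n) M) {z : Cn n} (hz : z ∈ c.target) :
    Function.Bijective (mfderiv 𝓘(ℂ, Cn n) 𝓘(ℂ, Cn n) c.symm z) := by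
  have : IsManifold 𝓘(ℂ, Cn n) 1 M := IsManifold.of_le (n := ω) le_top
  exact (mdifferentiable_of_mem_atlas (I := 𝓘(ℂ, Cn n)) hc).symm.mfderiv_bijective hz

variable {c : OpenPartialHomeomorph M (Cn n)} {z : Cn n}

theorem posDef_coeff (g : HermitianMetric n M) (hc : c ∈ atlas (Cn n) M) (hz : z ∈ c.target) :
    (g.coeff c z).PosDef :=
  g.posDef_formMatrix _ (mfderiv_symm_bijective hc hz).1

theorem quad_coeff_nonneg (g : HermitianMetric n M) (hc : c ∈ atlas (Cn n) M) (hz : z ∈ c.target)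
    (v : Cn n) : 0 ≤ quad (g.coeff c z) v := by
  rw [quad_eq_dotProduct]
  exact (g.posDef_coeff hc hz).posSemidef.re_dotProduct_nonneg _

theorem det_coeff_eq_ofReal (g : HermitianMetric n M) (hc : c ∈ atlas (Cn n) M)
    (hz : z ∈ c.target) : (g.coeff c z).det = ((g.coeff c z).det.re : ℂ) :=
  Complex.ext rfl (Complex.pos_iff.1 (g.posDef_coeff hc hz).det_pos).2.symm

theorem det_coeff_re_pos (g : HermitianMetric n M) (hc : c ∈ atlas (Cn n) M)
    (hz : z ∈ c.target) : 0 < (g.coeff c z).det.re :=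
  (Complex.pos_iff.1 (g.posDef_coeff hc hz).det_pos).1

theorem log_det_coeff_sub (g h : HermitianMetric n M) (hc : c ∈ atlas (Cn n) M)
    (hz : z ∈ c.target) :
    Real.log (h.coeff c z).det.re - Real.log (g.coeff c z).det.re =
      h.logDet (c.symm z) - g.logDet (c.symm z) :=
  log_det_formMatrix_sub g h _ (mfderiv_symm_bijective hc hz).1

/-- A metric is determined by its coefficients. -/
theorem ext_coeff {g h : HermitianMetric n M}
    (H : ∀ c ∈ atlas (Cn n) M, ∀ z ∈ c.target, ∀ i j, g.coeff c z i j = h.coeff c z i j) :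
    g = h := by
  ext1
  funext x
  have hx := mem_chart_source (Cn n) x
  have hc := chart_mem_atlas (Cn n) x
  have hz := (chartAt (Cn n) x).map_source hx
  -- The point c⁻¹(c(x)) equals x only propositionally; a free `y` allows substitution in the
  -- dependent type of the form.
  suffices ∀ y, (chartAt (Cn n) x).symm (chartAt (Cn n) x x) = y → g.form y = h.form y from
    this x ((chartAt (Cn n) x).left_inv hx)
  rintro y rfl
  have hb := mfderiv_symm_bijective hc hz
  ext u w
  obtain ⟨u, rfl⟩ := hb.2 u
  obtain ⟨w, rfl⟩ := hb.2 w
  have e1 := g.form_eq_sum _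
    (mfderiv 𝓘(ℂ, Cn n) 𝓘(ℂ, Cn n) (chartAt (Cn n) x).symm (chartAt (Cn n) x x)).toLinearMap u w
  have e2 := h.form_eq_sum _
    (mfderiv 𝓘(ℂ, Cn n) 𝓘(ℂ, Cn n) (chartAt (Cn n) x).symm (chartAt (Cn n) x x)).toLinearMap u w
  refine e1.trans (Eq.trans ?_ e2.symm)
  refine Finset.sum_congr rfl fun i _ => Finset.sum_congr rfl fun j _ => ?_
  rw [← coeff_eq_formMatrix, ← coeff_eq_formMatrix, H _ hc _ hz]

end HermitianMetric

end Metric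

end KahlerFlow

end

noncomputable section

namespace KahlerFlow

/-! ### Spatial derivatives of time integrals -/

section PartialDerivative

variable {E F : Type*} [NormedAddCommGroup E] [NormedSpace ℝ E]
  [NormedAddCommGroup F] [NormedSpace ℝ F]

/-- The derivative of a function on `ℝ × E` in the second variable. -/
def partialSnd (f : ℝ × E → F) (p : ℝ × E) : E →L[ℝ] F :=
  (fderiv ℝ f p).comp (ContinuousLinearMap.inr ℝ ℝ E)

theorem contDiffOn_partialSnd {f : ℝ × E → F} {O : Set (ℝ × E)} (hO : IsOpen O)
    (hf : ContDiffOn ℝ ∞ f O) : ContDiffOn ℝ ∞ (partialSnd f) O :=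
  (hf.fderiv_of_isOpen hO (m := ∞) (by simp)).clm_comp contDiffOn_const

theorem hasFDerivAt_partialSnd {f : ℝ × E → F} {O : Set (ℝ × E)} (hO : IsOpen O)
    (hf : ContDiffOn ℝ ∞ f O) {s : ℝ} {z : E} (hz : (s, z) ∈ O) :
    HasFDerivAt (fun y => f (s, y)) (partialSnd f (s, z)) z := by
  have h1 := ((hf.contDiffAt (hO.mem_nhds hz)).differentiableAt (by simp)).hasFDerivAt
  exact HasFDerivAt.comp z (f := fun y => (s, y)) h1 (hasFDerivAt_prodMk_right s z)

variable [ProperSpace E]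

/-- Differentiating twice under the integral sign. -/
theorem fderiv_fderiv_intervalIntegral {f : ℝ × E → ℝ} {I : Set ℝ} {U : Set E} (hI : IsOpen I)
    (hU : IsOpen U) (hf : ContDiffOn ℝ ∞ f (I ×ˢ U)) {a b : ℝ} (hab : a ≤ b)
    (hsub : Icc a b ⊆ I) {z : E} (hz : z ∈ U) :
    (∀ y ∈ U, DifferentiableAt ℝ (fun y => ∫ s in a..b, f (s, y)) y) ∧
    DifferentiableAt ℝ (fderiv ℝ fun y => ∫ s in a..b, f (s, y)) z ∧
    ∀ v w, IntervalIntegrable (fun s => fderiv ℝ (fderiv ℝ fun y => f (s, y)) z v w)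
        MeasureTheory.volume a b ∧
      fderiv ℝ (fderiv ℝ fun y => ∫ s in a..b, f (s, y)) z v w =
        ∫ s in a..b, fderiv ℝ (fderiv ℝ fun y => f (s, y)) z v w := by
  have hO : IsOpen (I ×ˢ U) := hI.prod hU
  have hf1 := contDiffOn_partialSnd hO hf
  have hf2 := contDiffOn_partialSnd hO hf1
  have hss : Icc a b ×ˢ U ⊆ I ×ˢ U := prod_mono_left hsub
  have d1 : ∀ y ∈ U, HasFDerivAt (fun y => ∫ s in a..b, f (s, y))
      (∫ s in a..b, partialSnd f (s, y)) y := fun y hy =>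
    hasFDerivAt_intervalIntegral (H := fun s y => f (s, y))
      (H' := fun s y => partialSnd f (s, y)) hab hU
      (fun s hs z hz => hasFDerivAt_partialSnd hO hf ⟨hsub hs, hz⟩)
      (hf.continuousOn.mono hss) (hf1.continuousOn.mono hss) hy
  have d2 : HasFDerivAt (fun y => ∫ s in a..b, partialSnd f (s, y))
      (∫ s in a..b, partialSnd (partialSnd f) (s, z)) z :=
    hasFDerivAt_intervalIntegral (H := fun s y => partialSnd f (s, y))
      (H' := fun s y => partialSnd (partialSnd f) (s, y)) hab hU
      (fun s hs z hz => hasFDerivAt_partialSnd hO hf1 ⟨hsub hs, hz⟩)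
      (hf1.continuousOn.mono hss) (hf2.continuousOn.mono hss) hz
  have hev : (fderiv ℝ fun y => ∫ s in a..b, f (s, y)) =ᶠ[𝓝 z]
      fun y => ∫ s in a..b, partialSnd f (s, y) := by
    filter_upwards [hU.mem_nhds hz] with y hy using (d1 y hy).fderiv
  have hs2 : ∀ s ∈ Icc a b, fderiv ℝ (fderiv ℝ fun y => f (s, y)) z =
      partialSnd (partialSnd f) (s, z) := by
    intro s hs
    have hev2 : (fderiv ℝ fun y => f (s, y)) =ᶠ[𝓝 z] fun y => partialSnd f (s, y) := by
      filter_upwards [hU.mem_nhds hz] with y hy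
      exact (hasFDerivAt_partialSnd hO hf ⟨hsub hs, hy⟩).fderiv
    rw [hev2.fderiv_eq]
    exact (hasFDerivAt_partialSnd hO hf1 ⟨hsub hs, hz⟩).fderiv
  have hc2 : ContinuousOn (fun s => partialSnd (partialSnd f) (s, z)) (uIcc a b) := by
    rw [uIcc_of_le hab]
    exact hf2.continuousOn.comp (f := fun s => (s, z)) (by fun_prop) fun s hs => ⟨hsub hs, hz⟩
  refine ⟨fun y hy => (d1 y hy).differentiableAt,
    d2.differentiableAt.congr_of_eventuallyEq hev, fun v w => ⟨?_, ?_⟩⟩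
  · refine ContinuousOn.intervalIntegrable ((hc2.clm_apply
      (continuousOn_const (c := v))).clm_apply (continuousOn_const (c := w)) |>.congr
        fun s hs => ?_)
    rw [uIcc_of_le hab] at hs
    simp only [hs2 s hs]
  · rw [hev.fderiv_eq, d2.fderiv, ContinuousLinearMap.intervalIntegral_apply hc2.intervalIntegrable,
      ContinuousLinearMap.intervalIntegral_apply
        (hc2.clm_apply continuousOn_const).intervalIntegrable]
    refine intervalIntegral.integral_congr fun s hs => ?_
    rw [uIcc_of_le hab] at hs
    simp only [hs2 s hs]

end PartialDerivative

/-! ### The flow as an equation for log det -/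

section Flow

open scoped Matrix ComplexOrder

variable {n : ℕ} {M : Type*} [TopologicalSpace M] [ChartedSpace (Cn n) M]
  [IsManifold 𝓘(ℂ, Cn n) ω M]

namespace IsKahlerRicciFlow

variable {T : ℝ} {g g₁ g₂ : ℝ → HermitianMetric n M} {c : OpenPartialHomeomorph M (Cn n)}

theorem contDiffOn_log_det (hg : IsKahlerRicciFlow T g) (hc : c ∈ atlas (Cn n) M) :
    ContDiffOn ℝ ∞ (fun p : ℝ × Cn n => Real.log ((g p.1).coeff c p.2).det.re)
      (Ioo 0 T ×ˢ c.target) := by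
  have hO : IsOpen (Ioo 0 T ×ˢ c.target) := isOpen_Ioo.prod c.open_target
  intro p hp
  have h1 : ContDiffAt ℝ ∞ (fun p : ℝ × Cn n => ((g p.1).coeff c p.2).det) p :=
    contDiffAt_det fun i j => (hg.smooth c hc i j).contDiffAt (hO.mem_nhds hp)
  have h2 : ContDiffAt ℝ ∞ (fun p : ℝ × Cn n => ((g p.1).coeff c p.2).det.re) p :=
    Complex.reCLM.contDiff.contDiffAt.comp p h1
  exact (h2.log ((g p.1).det_coeff_re_pos hc hp.2).ne').contDiffWithinAt

theorem continuousOn_log_det (hg : IsKahlerRicciFlow T g) (hc : c ∈ atlas (Cn n) M) :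
    ContinuousOn (fun p : ℝ × Cn n => Real.log ((g p.1).coeff c p.2).det.re)
      (Icc 0 T ×ˢ c.target) := by
  refine ContinuousOn.log (Complex.continuous_re.comp_continuousOn ?_) fun p hp =>
    ((g p.1).det_coeff_re_pos hc hp.2).ne'
  simp only [Matrix.det_apply]
  refine continuousOn_finsetSum _ fun σ _ => ContinuousOn.const_smul ?_ _
  exact continuousOn_finsetProd _ fun i _ => hg.continuous c hc _ _

theorem contDiffAt_log_det_slice (hg : IsKahlerRicciFlow T g) (hc : c ∈ atlas (Cn n) M) {s : ℝ}
    (hs : s ∈ Ioo 0 T) {z : Cn n} (hz : z ∈ c.target) :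
    ContDiffAt ℝ 2 (fun y => Real.log ((g s).coeff c y).det.re) z := by
  have hO : IsOpen (Ioo 0 T ×ˢ c.target) := isOpen_Ioo.prod c.open_target
  have h1 := (hg.contDiffOn_log_det hc).contDiffAt (hO.mem_nhds (x := (s, z)) ⟨hs, hz⟩)
  exact (h1.comp z (f := fun y => (s, y)) (by fun_prop)).of_le
      (WithTop.coe_le_coe.2 (le_top : (2 : ℕ∞) ≤ ⊤))

theorem neg_ricci_eq (hg : IsKahlerRicciFlow T g) (hc : c ∈ atlas (Cn n) M) {s : ℝ}
    (hs : s ∈ Ioo 0 T) {z : Cn n} (hz : z ∈ c.target) (i j : Fin n) :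
    -ricci ((g s).coeff c) z i j =
      dz i (dzbar j fun y => (Real.log ((g s).coeff c y).det.re : ℂ)) z := by
  have hO : IsOpen (Ioo 0 T ×ˢ c.target) := isOpen_Ioo.prod c.open_target
  have h1 : ∀ i j, ContDiffAt ℝ 2 (fun y => (g s).coeff c y i j) z := fun i j =>
    (((hg.smooth c hc i j).contDiffAt (hO.mem_nhds (x := (s, z)) ⟨hs, hz⟩)).comp z
      (f := fun y => (s, y)) (by fun_prop)).of_le
      (WithTop.coe_le_coe.2 (le_top : (2 : ℕ∞) ≤ ⊤))
  have hdet : ((g s).coeff c z).det ∈ Complex.slitPlane :=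
    Complex.mem_slitPlane_iff.2 (Or.inl ((g s).det_coeff_re_pos hc hz))
  rw [ricci_eq_neg_ddbar_log_det h1 hdet, neg_neg]
  have hev : (fun y => Complex.log ((g s).coeff c y).det) =ᶠ[𝓝 z]
      fun y => (Real.log ((g s).coeff c y).det.re : ℂ) := by
    filter_upwards [c.open_target.mem_nhds hz] with y hy
    rw [Complex.ofReal_log ((g s).det_coeff_re_pos hc hy).le, ← (g s).det_coeff_eq_ofReal hc hy]
  refine dz_congr ?_ i
  filter_upwards [hev.fderiv (𝕜 := ℝ)] with y hy
  simp only [dzbar, hy]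

/-- This is ∂g/∂t = -Ric = ∂∂̄ log det g evaluated on v; the 4 comes from the normalisation of
`levi`. -/
theorem hasDerivAt_quad (hg : IsKahlerRicciFlow T g) (hc : c ∈ atlas (Cn n) M) {s : ℝ}
    (hs : s ∈ Ioo 0 T) {z : Cn n} (hz : z ∈ c.target) (v : Cn n) :
    HasDerivAt (fun s => quad ((g s).coeff c z) v)
      (levi (fun y => Real.log ((g s).coeff c y).det.re) z v / 4) s := by
  have h1 : HasDerivAt (fun s => ∑ i, ∑ j, v i * (starRingEnd ℂ) (v j) * (g s).coeff c z i j)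
      (∑ i, ∑ j, v i * (starRingEnd ℂ) (v j) * -ricci ((g s).coeff c) z i j) s :=
    HasDerivAt.fun_sum fun i _ => HasDerivAt.fun_sum fun j _ =>
      (hg.flow c hc z hz s hs i j).const_mul _
  simp only [hg.neg_ricci_eq hc hs hz] at h1
  rw [sum_ddbar_eq_levi (hg.contDiffAt_log_det_slice hc hs hz)] at h1
  exact (Complex.reCLM.hasFDerivAt.comp_hasDerivAt s h1)

/-- `∂∂̄` of the integral of `log det g₂ - log det g₁` is the increment of `g₂ - g₁`. -/
theorem levi_integral_log_det (hg₁ : IsKahlerRicciFlow T g₁) (hg₂ : IsKahlerRicciFlow T g₂)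
    (hc : c ∈ atlas (Cn n) M) {a b : ℝ} (ha : 0 < a) (hab : a ≤ b) (hb : b < T) {z : Cn n}
    (hz : z ∈ c.target) :
    TwiceDifferentiableAt (fun y => ∫ s in a..b,
      ((g₂ s).logDet (c.symm y) - (g₁ s).logDet (c.symm y))) z ∧
    ∀ v, levi (fun y => ∫ s in a..b,
      ((g₂ s).logDet (c.symm y) - (g₁ s).logDet (c.symm y))) z v / 4 =
      (quad ((g₂ b).coeff c z) v - quad ((g₁ b).coeff c z) v) -
        (quad ((g₂ a).coeff c z) v - quad ((g₁ a).coeff c z) v) := by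
  set f : ℝ × Cn n → ℝ := fun p =>
    Real.log ((g₂ p.1).coeff c p.2).det.re - Real.log ((g₁ p.1).coeff c p.2).det.re with hf
  have hsm : ContDiffOn ℝ ∞ f (Ioo 0 T ×ˢ c.target) :=
    (hg₂.contDiffOn_log_det hc).sub (hg₁.contDiffOn_log_det hc)
  have hsub : Icc a b ⊆ Ioo 0 T := fun s hs => ⟨ha.trans_le hs.1, hs.2.trans_lt hb⟩
  obtain ⟨k1, k2, k3⟩ :=
    fderiv_fderiv_intervalIntegral isOpen_Ioo c.open_target hsm hab hsub hz
  have hev : (fun y => ∫ s in a..b,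
      ((g₂ s).logDet (c.symm y) - (g₁ s).logDet (c.symm y))) =ᶠ[𝓝 z]
      fun y => ∫ s in a..b, f (s, y) := by
    filter_upwards [c.open_target.mem_nhds hz] with y hy
    simp only [hf, HermitianMetric.log_det_coeff_sub _ _ hc hy]
  refine ⟨⟨?_, k2.congr_of_eventuallyEq hev.fderiv⟩, fun v => ?_⟩
  · filter_upwards [c.open_target.mem_nhds hz, hev.eventually_nhds] with y hy hy2
    exact (k1 y hy).congr_of_eventuallyEq hy2
  · rw [levi_congr hev]
    -- The integrand of the differentiated potential is the time derivative of g₂ - g₁, so the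
    -- fundamental theorem of calculus gives the increment.
    have hd : ∀ s ∈ uIcc a b, HasDerivAt
        (fun s => quad ((g₂ s).coeff c z) v - quad ((g₁ s).coeff c z) v)
        (levi (fun y => f (s, y)) z v / 4) s := by
      intro s hs
      rw [uIcc_of_le hab] at hs
      have h1 := (hg₂.hasDerivAt_quad hc (hsub hs) hz v).sub
        (hg₁.hasDerivAt_quad hc (hsub hs) hz v)
      rwa [← sub_div, ← levi_sub
        (hg₂.contDiffAt_log_det_slice hc (hsub hs) hz).twiceDifferentiableAt
        (hg₁.contDiffAt_log_det_slice hc (hsub hs) hz).twiceDifferentiableAt] at h1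
    have hInt : IntervalIntegrable (fun s => levi (fun y => f (s, y)) z v / 4)
        MeasureTheory.volume a b :=
      ((k3 v v).1.add (k3 (Complex.I • v) (Complex.I • v)).1).div_const 4
    rw [← intervalIntegral.integral_eq_sub_of_hasDerivAt hd hInt,
      intervalIntegral.integral_div]
    congr 1
    simp only [levi]
    rw [(k3 v v).2, (k3 (Complex.I • v) (Complex.I • v)).2,
      intervalIntegral.integral_add (k3 v v).1 (k3 (Complex.I • v) (Complex.I • v)).1]

end IsKahlerRicciFlow

end Flow

end KahlerFlow

end

noncomputable section

namespace KahlerFlow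

/-! ### Continuity up to the initial time -/

section Continuity

variable {n : ℕ} {M : Type*} [TopologicalSpace M] [ChartedSpace (Cn n) M]

theorem quad_smul (G : Matrix (Fin n) (Fin n) ℂ) (r : ℝ) (v : Cn n) :
    quad G (r • v) = r ^ 2 * quad G v := by
  simp only [quad, Complex.re_sum, Finset.mul_sum]
  refine Finset.sum_congr rfl fun i _ => Finset.sum_congr rfl fun j _ => ?_
  have : (r • v) i * (starRingEnd ℂ) ((r • v) j) * G i j =
      ((r ^ 2 : ℝ) : ℂ) * (v i * (starRingEnd ℂ) (v j) * G i j) := by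
    simp only [PiLp.smul_apply, Complex.real_smul, map_mul, Complex.conj_ofReal]
    push_cast
    ring
  rw [this, Complex.re_ofReal_mul]

namespace IsKahlerRicciFlow

variable {T : ℝ} {g g₁ g₂ : ℝ → HermitianMetric n M}

/-- Clamping the time to [0, T] turns continuity on a closed interval into continuity at every real
time, so that full neighbourhoods can be used at the end points. -/
theorem continuousAt_coeff_projIcc (hT : 0 ≤ T) (hg : IsKahlerRicciFlow T g)
    {c : OpenPartialHomeomorph M (Cn n)} (hc : c ∈ atlas (Cn n) M) {p : ℝ × Cn n}
    (hp : p.2 ∈ c.target) (i j : Fin n) :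
    ContinuousAt (fun p : ℝ × Cn n => (g (projIcc 0 T hT p.1)).coeff c p.2 i j) p := by
  have h1 : ContinuousOn (fun p : ℝ × Cn n => (g (projIcc 0 T hT p.1)).coeff c p.2 i j)
      (univ ×ˢ c.target) :=
    (hg.continuous c hc i j).comp
      (f := fun p : ℝ × Cn n => ((projIcc 0 T hT p.1 : ℝ), p.2))
      (by fun_prop) fun p hp => ⟨Subtype.coe_prop _, hp.2⟩
  exact h1.continuousAt ((isOpen_univ.prod c.open_target).mem_nhds ⟨mem_univ _, hp⟩)

variable [IsManifold 𝓘(ℂ, Cn n) ω M]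

/-- The function `log (det g₂ / det g₁)`, extended to all times by its values at `0` and `T`, is
continuous. -/
theorem continuous_logDet_sub (hT : 0 ≤ T) (hg₁ : IsKahlerRicciFlow T g₁)
    (hg₂ : IsKahlerRicciFlow T g₂) :
    Continuous fun p : M × ℝ =>
      (g₂ (projIcc 0 T hT p.2)).logDet p.1 - (g₁ (projIcc 0 T hT p.2)).logDet p.1 := by
  rw [continuous_iff_continuousAt]
  rintro ⟨x, t⟩
  set c := chartAt (Cn n) x
  have hc : c ∈ atlas (Cn n) M := chart_mem_atlas _ x
  have hx : x ∈ c.source := mem_chart_source _ x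
  have h1 : ContinuousOn (fun p : ℝ × Cn n => Real.log ((g₂ p.1).coeff c p.2).det.re -
      Real.log ((g₁ p.1).coeff c p.2).det.re) (Icc 0 T ×ˢ c.target) :=
    (hg₂.continuousOn_log_det hc).sub (hg₁.continuousOn_log_det hc)
  have h2 : ContinuousOn (fun p : M × ℝ => ((projIcc 0 T hT p.2 : ℝ), c p.1))
      (c.source ×ˢ univ) := by
    refine ContinuousOn.prodMk (by fun_prop) ?_
    exact c.continuousOn.comp continuousOn_fst fun p hp => hp.1
  have h3 := h1.comp h2 fun p hp => ⟨Subtype.coe_prop _, c.map_source hp.1⟩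
  have hO : c.source ×ˢ univ ∈ 𝓝 (x, t) :=
    (c.open_source.prod isOpen_univ).mem_nhds ⟨hx, mem_univ _⟩
  refine (h3.continuousAt hO).congr ?_
  filter_upwards [hO] with p hp
  simp only [Function.comp]
  rw [HermitianMetric.log_det_coeff_sub _ _ hc (c.map_source hp.1), c.left_inv hp.1]

/-- Two flows with the same initial value are close to each other for small times, uniformly on
compact sets. -/
theorem eventually_normSq_sub_le (hT : 0 ≤ T) (hg₁ : IsKahlerRicciFlow T g₁)
    (hg₂ : IsKahlerRicciFlow T g₂) (h0 : g₁ 0 = g₂ 0) {K : Set M} (hK : IsCompact K) {η : ℝ}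
    (hη : 0 < η) :
    ∀ᶠ δ in 𝓝 (0 : ℝ), δ ∈ Icc 0 T → ∀ x ∈ K, ∀ t ∈ Icc 0 T,
      ∀ v : TangentSpace 𝓘(ℂ, Cn n) x,
        (g₂ δ).normSq x v - (g₁ δ).normSq x v ≤ η * (g₁ t).normSq x v := by
  suffices H : ∀ᶠ δ in 𝓝 (0 : ℝ), ∀ x ∈ K, δ ∈ Icc 0 T → ∀ t ∈ Icc 0 T,
      ∀ v : TangentSpace 𝓘(ℂ, Cn n) x,
        (g₂ δ).normSq x v - (g₁ δ).normSq x v ≤ η * (g₁ t).normSq x v by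
    filter_upwards [H] with δ h hδ x hx using h x hx hδ
  refine hK.eventually_forall_of_forall_eventually fun x _ => ?_
  set c := chartAt (Cn n) x
  have hc : c ∈ atlas (Cn n) M := chart_mem_atlas _ x
  have hx : x ∈ c.source := mem_chart_source _ x
  let q : (ℝ → HermitianMetric n M) → ℝ → Cn n → Cn n → ℝ := fun g s z v =>
    quad ((g (projIcc 0 T hT s)).coeff c z) v
  have hq : ∀ g, IsKahlerRicciFlow T g → ∀ p : ℝ × Cn n × Cn n, p.2.1 ∈ c.target →
      ContinuousAt (fun p : ℝ × Cn n × Cn n => q g p.1 p.2.1 p.2.2) p := by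
    intro g hg p hp
    refine Complex.continuous_re.continuousAt.comp ?_
    refine tendsto_finsetSum _ fun i _ => tendsto_finsetSum _ fun j _ => ?_
    refine ContinuousAt.mul (by fun_prop) ?_
    exact ContinuousAt.comp (f := fun p : ℝ × Cn n × Cn n => (p.1, p.2.1))
      (hg.continuousAt_coeff_projIcc hT hc (p := (p.1, p.2.1)) hp i j) (by fun_prop)
  -- Both sides are homogeneous of degree 2 in the vector, so unit vectors suffice, and these form a
  -- compact set together with the times t.
  have hcomp : IsCompact (Icc (0 : ℝ) T ×ˢ Metric.sphere (0 : Cn n) 1) :=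
    isCompact_Icc.prod (isCompact_sphere _ _)
  have key : ∀ᶠ a in 𝓝 ((0 : ℝ), c x), ∀ b ∈ Icc (0 : ℝ) T ×ˢ Metric.sphere (0 : Cn n) 1,
      q g₂ a.1 a.2 b.2 - q g₁ a.1 a.2 b.2 < η * q g₁ b.1 a.2 b.2 := by
    refine hcomp.eventually_forall_of_forall_eventually fun b hb => ?_
    have hz : c x ∈ c.target := c.map_source hx
    have c1 : ContinuousAt (fun w : (ℝ × Cn n) × ℝ × Cn n => q g₂ w.1.1 w.1.2 w.2.2)
        ((0, c x), b) :=
      ContinuousAt.comp (g := fun p : ℝ × Cn n × Cn n => q g₂ p.1 p.2.1 p.2.2)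
        (f := fun w : (ℝ × Cn n) × ℝ × Cn n => (w.1.1, w.1.2, w.2.2)) (x := ((0, c x), b))
        (hq g₂ hg₂ (0, c x, b.2) hz) (by fun_prop)
    have c2 : ContinuousAt (fun w : (ℝ × Cn n) × ℝ × Cn n => q g₁ w.1.1 w.1.2 w.2.2)
        ((0, c x), b) :=
      ContinuousAt.comp (g := fun p : ℝ × Cn n × Cn n => q g₁ p.1 p.2.1 p.2.2)
        (f := fun w : (ℝ × Cn n) × ℝ × Cn n => (w.1.1, w.1.2, w.2.2)) (x := ((0, c x), b))
        (hq g₁ hg₁ (0, c x, b.2) hz) (by fun_prop)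
    have c3 : ContinuousAt (fun w : (ℝ × Cn n) × ℝ × Cn n => q g₁ w.2.1 w.1.2 w.2.2)
        ((0, c x), b) :=
      ContinuousAt.comp (g := fun p : ℝ × Cn n × Cn n => q g₁ p.1 p.2.1 p.2.2)
        (f := fun w : (ℝ × Cn n) × ℝ × Cn n => (w.2.1, w.1.2, w.2.2)) (x := ((0, c x), b))
        (hq g₁ hg₁ (b.1, c x, b.2) hz) (by fun_prop)
    refine (c1.sub c2).eventually_lt (c3.const_mul η) ?_
    -- At δ = 0 the left side vanishes because the initial metrics agree, while the right side is
    -- positive.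
    have e0 : (projIcc 0 T hT 0 : ℝ) = 0 := by simp [projIcc]
    have hpos : 0 < q g₁ b.1 (c x) b.2 := by
      have hb0 : b.2 ≠ 0 := by
        intro hb0
        have := hb.2
        simp [hb0] at this
      simp only [q]
      rw [HermitianMetric.quad_coeff]
      exact HermitianMetric.pos _ _ _ fun h => hb0
        ((mfderiv_symm_bijective hc hz).1 (h.trans (map_zero _).symm))
    simp only [q] at hpos ⊢
    simp only [Pi.sub_apply, e0, h0, sub_self]
    exact mul_pos hη hpos
  have htend : Tendsto (fun p : ℝ × M => (p.1, c p.2)) (𝓝 (0, x)) (𝓝 (0, c x)) :=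
    continuousAt_fst.prodMk ((c.continuousAt hx).comp continuousAt_snd)
  have hsrc : ∀ᶠ p : ℝ × M in 𝓝 (0, x), p.2 ∈ c.source :=
    continuousAt_snd.eventually_mem (c.open_source.mem_nhds hx)
  filter_upwards [htend.eventually key, hsrc] with p hp hps hδ t ht
  have hz := c.map_source hps
  suffices ∀ y, c.symm (c p.2) = y → ∀ v : TangentSpace 𝓘(ℂ, Cn n) y,
      (g₂ p.1).normSq y v - (g₁ p.1).normSq y v ≤ η * (g₁ t).normSq y v from
    this p.2 (c.left_inv hps)
  rintro y rfl v
  obtain ⟨w, rfl⟩ := (mfderiv_symm_bijective hc hz).2 v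
  change Cn n at w
  rw [← HermitianMetric.quad_coeff, ← HermitianMetric.quad_coeff, ← HermitianMetric.quad_coeff]
  by_cases hw : w = 0
  · subst hw
    simp [quad]
  have hn : ‖w‖ ≠ 0 := norm_ne_zero_iff.2 hw
  have h1 := hp (t, ‖w‖⁻¹ • w) ⟨ht, by simp [norm_smul, hn]⟩
  simp only [q, projIcc_of_mem hT hδ, projIcc_of_mem hT ht, quad_smul] at h1
  have hn2 : 0 < ‖w‖⁻¹ ^ 2 := by positivity
  have h2 : ‖w‖⁻¹ ^ 2 * (quad ((g₂ p.1).coeff c (c p.2)) w - quad ((g₁ p.1).coeff c (c p.2)) w) <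
      ‖w‖⁻¹ ^ 2 * (η * quad ((g₁ t).coeff c (c p.2)) w) := by linarith
  exact (lt_of_mul_lt_mul_left h2 hn2.le).le

end IsKahlerRicciFlow

end Continuity

end KahlerFlow

end

noncomputable section

namespace KahlerFlow

/-! ### The barrier built from the exhaustion function -/

section Barrier

/-- The profile of the barrier: it tends to infinity where `log (y + L)` tends to `R`. -/
def barrier (R L y : ℝ) : ℝ := -Real.log (1 - Real.log (y + L) / R)

variable {R L y : ℝ}

theorem hasDerivAt_barrier (hR : 0 < R) (hy : 0 < y + L) (hu : 0 < 1 - Real.log (y + L) / R) :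
    HasDerivAt (barrier R L) (R * (y + L) * (1 - Real.log (y + L) / R))⁻¹ y := by
  have h1 : HasDerivAt (fun y => y + L) 1 y := (hasDerivAt_id y).add_const L
  have h2 := ((((h1.log hy.ne').div_const R).const_sub 1).log hu.ne').neg
  convert! h2 using 1
  field_simp

theorem hasDerivAt_deriv_barrier (hR : 0 < R) (hy : 0 < y + L)
    (hu : 0 < 1 - Real.log (y + L) / R) :
    HasDerivAt (fun y => (R * (y + L) * (1 - Real.log (y + L) / R))⁻¹)
      ((1 - R * (1 - Real.log (y + L) / R)) / (R * (y + L) * (1 - Real.log (y + L) / R)) ^ 2)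
      y := by
  have h1 : HasDerivAt (fun y => y + L) 1 y := (hasDerivAt_id y).add_const L
  have h2 := ((h1.const_mul R).mul (((h1.log hy.ne').div_const R).const_sub 1)).inv
    (mul_pos (mul_pos hR hy) hu).ne'
  convert! h2 using 1
  simp only [Pi.mul_apply]
  congr 1
  field_simp
  ring

theorem contDiffAt_barrier (hy : 0 < y + L) (hu : 0 < 1 - Real.log (y + L) / R) :
    ContDiffAt ℝ 2 (barrier R L) y := by
  unfold barrier
  have h1 : ContDiffAt ℝ 2 (fun y : ℝ => y + L) y := contDiffAt_id.add contDiffAt_const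
  exact ((contDiffAt_const.sub ((h1.log hy.ne').div_const R)).log hu.ne').neg

theorem barrier_nonneg (hR : 0 < R) (hy : 1 ≤ y + L) (hu : 0 < 1 - Real.log (y + L) / R) :
    0 ≤ barrier R L y := by
  rw [barrier, neg_nonneg]
  refine Real.log_nonpos hu.le ?_
  have : 0 ≤ Real.log (y + L) / R := div_nonneg (Real.log_nonneg hy) hR.le
  linarith

variable {n : ℕ} {M : Type*} [TopologicalSpace M] [ChartedSpace (Cn n) M]

theorem IsBoundedExhaustion.contDiffAt {ghat : HermitianMetric n M} {ζ : M → ℝ}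
    (hζ : IsBoundedExhaustion ghat ζ) (x : M) :
    ContDiffAt ℝ 2 (fun y => ζ ((chartAt (Cn n) x).symm y)) (chartAt (Cn n) x x) := by
  have h := (contMDiffAt_iff.1 (hζ.contMDiff x)).2
  simpa [contDiffWithinAt_univ, Function.comp_def, chartAt_self_eq] using h

theorem IsBoundedExhaustion.isCompact_le {ghat : HermitianMetric n M} {ζ : M → ℝ}
    (hζ : IsBoundedExhaustion ghat ζ) (r : ℝ) : IsCompact {x | ζ x ≤ r} := by
  obtain ⟨K, hK, hsub⟩ := mem_cocompact.1 (hζ.tendsto.eventually_gt_atTop r)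
  refine hK.of_isClosed_subset (isClosed_le hζ.contMDiff.continuous continuous_const) ?_
  intro x hx
  by_contra hxK
  exact absurd hx (not_le.2 (show r < ζ x from hsub hxK))

variable [IsManifold 𝓘(ℂ, Cn n) ω M]

/-- The form `∂∂̄` of the barrier is bounded above by a small multiple of any metric that dominates
`ghat / ζ`. -/
theorem IsBoundedExhaustion.exists_levi_barrier_le {ghat : HermitianMetric n M} {ζ : M → ℝ}
    (hζ : IsBoundedExhaustion ghat ζ) {K : ℝ} (hK : 0 ≤ K) :
    ∃ C : ℝ, 0 ≤ C ∧ ∀ (g : HermitianMetric n M),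
      (∀ x (v : TangentSpace 𝓘(ℂ, Cn n) x), ghat.normSq x v ≤ (ζ x + K) * g.normSq x v) →
      ∀ R : ℝ, 1 ≤ R → ∀ x : M, 0 < 1 - Real.log (ζ x + (K + 1)) / R → ∀ v : Cn n,
        levi (fun y => barrier R (K + 1) (ζ ((chartAt (Cn n) x).symm y)))
            (chartAt (Cn n) x x) v / 4 ≤
          C / R * ((1 - Real.log (ζ x + (K + 1)) / R)⁻¹) ^ 2 *
            quad (g.coeff (chartAt (Cn n) x) (chartAt (Cn n) x x)) v := by
  obtain ⟨C₂, hC₂⟩ := hζ.grad_bounded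
  obtain ⟨C₁, hC₁⟩ := hζ.ddbar_bounded
  refine ⟨√C₁ + |C₂|, by positivity, fun g hg R hR x hu v => ?_⟩
  set c := chartAt (Cn n) x with hcdef
  have hc : c ∈ atlas (Cn n) M := chart_mem_atlas _ x
  have hx : x ∈ c.source := mem_chart_source _ x
  have hz : c x ∈ c.target := c.map_source hx
  have hf := hζ.contDiffAt x
  rw [← hcdef] at hf
  have hd := hf.differentiableAt two_ne_zero
  have hval : ζ (c.symm (c x)) = ζ x := by rw [c.left_inv hx]
  have hR0 : 0 < R := by linarith
  set Z := ζ x + (K + 1) with hZ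
  have hZ1 : 1 ≤ Z := by have := hζ.pos x; rw [hZ]; linarith
  set u := 1 - Real.log Z / R with hudef
  have hu1 : u ≤ 1 := by
    have : 0 ≤ Real.log Z / R := div_nonneg (Real.log_nonneg hZ1) hR0.le
    rw [hudef]; linarith
  have hq := hg (c.symm (c x)) (mfderiv 𝓘(ℂ, Cn n) 𝓘(ℂ, Cn n) c.symm (c x) v)
  rw [← HermitianMetric.quad_coeff, ← HermitianMetric.quad_coeff, hval] at hq
  set q := quad (g.coeff c (c x)) v with hqdef
  have hq0 : 0 ≤ q := g.quad_coeff_nonneg hc hz v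
  have hqZ : quad (ghat.coeff c (c x)) v ≤ Z * q :=
    hq.trans (mul_le_mul_of_nonneg_right (by rw [hZ]; linarith) hq0)
  have hG := ghat.posDef_coeff hc hz
  have hlevi : levi (fun y => ζ (c.symm y)) (c x) v / 4 ≤ √C₁ * (Z * q) := by
    have h1 : quad (Matrix.of fun i j => dz i (dzbar j fun y => (ζ (c.symm y) : ℂ)) (c x)) v ≤
        √C₁ * quad (ghat.coeff c (c x)) v := by
      refine quad_le_of_normSq_le hG ?_ (hC₁ c hc (c x) hz) v
      ext i j
      exact ddbar_ofReal_conj hf j i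
    have h2 : quad (Matrix.of fun i j => dz i (dzbar j fun y => (ζ (c.symm y) : ℂ)) (c x)) v =
        levi (fun y => ζ (c.symm y)) (c x) v / 4 := by
      simp only [quad, Matrix.of_apply]
      rw [sum_ddbar_eq_levi hf, Complex.ofReal_re]
    rw [← h2]
    exact h1.trans (mul_le_mul_of_nonneg_left hqZ (Real.sqrt_nonneg _))
  have hgrad : (fderiv ℝ (fun y => ζ (c.symm y)) (c x) v ^ 2 +
      fderiv ℝ (fun y => ζ (c.symm y)) (c x) (Complex.I • v) ^ 2) / 4 ≤ |C₂| * (Z * q) := by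
    rw [← normSq_sum_dz hd]
    refine (normSq_sum_le_of_gradNormSq_le hG (C := |C₂|) ?_ v).trans
      (mul_le_mul_of_nonneg_left hqZ (abs_nonneg _))
    have := (hC₂ c hc (c x) hz).trans (le_abs_self C₂)
    simpa only [gradNormSq, dzbar_ofReal hd] using this
  have hcomp := levi_comp hf (φ := barrier R (K + 1))
    (φ' := fun y => (R * (y + (K + 1)) * (1 - Real.log (y + (K + 1)) / R))⁻¹)
    (φ'' := (1 - R * u) / (R * Z * u) ^ 2) ?_ ?_ v
  rotate_left
  · rw [hval]
    have hcZ : ContinuousAt (fun y => y + (K + 1)) (ζ x) := by fun_prop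
    have e1 : ∀ᶠ y in 𝓝 (ζ x), 0 < y + (K + 1) :=
      hcZ.eventually (lt_mem_nhds (by linarith : (0 : ℝ) < ζ x + (K + 1)))
    have hcu : ContinuousAt (fun y => 1 - Real.log (y + (K + 1)) / R) (ζ x) :=
      continuousAt_const.sub ((hcZ.log (by linarith : ζ x + (K + 1) ≠ 0)).div_const R)
    have e2 : ∀ᶠ y in 𝓝 (ζ x), 0 < 1 - Real.log (y + (K + 1)) / R :=
      hcu.eventually (lt_mem_nhds hu)
    filter_upwards [e1, e2] with y h1 h2 using hasDerivAt_barrier hR0 h1 h2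
  · rw [hval]
    exact hasDerivAt_deriv_barrier hR0 (by linarith) hu
  rw [hcomp, hval]
  simp only [← hZ, ← hudef]
  set D := fderiv ℝ (fun y => ζ (c.symm y)) (c x) v ^ 2 +
      fderiv ℝ (fun y => ζ (c.symm y)) (c x) (Complex.I • v) ^ 2 with hD
  have hD0 : 0 ≤ D := by positivity
  have hZ0 : 0 < Z := by linarith
  calc ((R * Z * u)⁻¹ * levi (fun y => ζ (c.symm y)) (c x) v +
        (1 - R * u) / (R * Z * u) ^ 2 * D) / 4
      = (R * Z * u)⁻¹ * (levi (fun y => ζ (c.symm y)) (c x) v / 4) +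
        (1 - R * u) / (R * Z * u) ^ 2 * (D / 4) := by ring
    -- With b the barrier as a function of ζ, ∂∂̄b = b' ∂∂̄ζ + b'' ∂ζ ∧ ∂̄ζ. The two bounds on ζ are
    -- measured in ĝ and cost a factor Z when passing to g; the negative part of b'' is dropped.
    _ ≤ (R * Z * u)⁻¹ * (√C₁ * (Z * q)) + 1 / (R * Z * u) ^ 2 * (|C₂| * (Z * q)) := by
        refine add_le_add (mul_le_mul_of_nonneg_left hlevi (by positivity)) ?_
        refine mul_le_mul ?_ hgrad (by positivity) (by positivity)
        gcongr
        have : 0 ≤ R * u := by positivity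
        linarith
    _ = √C₁ / R * q * u⁻¹ + |C₂| / R * q * u⁻¹ ^ 2 * (R * Z)⁻¹ := by
        field_simp
    -- The shift by K + 1 gives Z ≥ 1, hence 0 < u ≤ 1 and R Z ≥ 1: both terms fit under u⁻² / R.
    _ ≤ √C₁ / R * q * u⁻¹ ^ 2 + |C₂| / R * q * u⁻¹ ^ 2 * 1 := by
        have h1 : 1 ≤ u⁻¹ := (one_le_inv₀ hu).2 hu1
        have h2 : u⁻¹ ≤ u⁻¹ ^ 2 := le_self_pow₀ h1 two_ne_zero
        have h3 : (R * Z)⁻¹ ≤ 1 := inv_le_one_of_one_le₀ (one_le_mul_of_one_le_of_one_le hR hZ1)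
        gcongr
    _ = _ := by ring

end Barrier

end KahlerFlow

end

noncomputable section

namespace KahlerFlow

/-! ### The maximum principle and uniqueness -/

section MaximumPrinciple

/-- Slopes towards the left suffice, which matters because the maximum may be attained at the last
time. -/
theorem deriv_nonneg_of_le_left {f : ℝ → ℝ} {f' a t : ℝ} (hf : HasDerivAt f f' t) (hat : a < t)
    (hm : ∀ s ∈ Icc a t, f s ≤ f t) : 0 ≤ f' := by
  have h1 := (hasDerivWithinAt_iff_tendsto_slope' (self_notMem_Iio (a := t))).1
    (hf.hasDerivWithinAt (s := Iio t))
  refine ge_of_tendsto h1 ?_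
  filter_upwards [Ioo_mem_nhdsLT hat] with s hs
  rw [slope_comm, slope_def_field]
  exact div_nonneg (sub_nonneg.2 (hm s ⟨hs.1.le, hs.2.le⟩)) (sub_nonneg.2 hs.2.le)

variable {n : ℕ} {M : Type*} [TopologicalSpace M] [ChartedSpace (Cn n) M]
  [IsManifold 𝓘(ℂ, Cn n) ω M]
  {T : ℝ} {g₁ g₂ : ℝ → HermitianMetric n M} {ghat : HermitianMetric n M} {ζ : M → ℝ}

namespace IsKahlerRicciFlow

/-- The spatial part of the maximum principle: if the potential minus a multiple of the barrier has
a local maximum at `x`, then `g₂ ≤ (1 + η + β) g₁` there, so that the determinants compare. -/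
theorem logDet_sub_le_of_isLocalMax (hg₁ : IsKahlerRicciFlow T g₁) (hg₂ : IsKahlerRicciFlow T g₂)
    (hζ : IsBoundedExhaustion ghat ζ) {L R η κ β a t : ℝ} {x : M} (ha : 0 < a) (hat : a ≤ t)
    (htT : t < T) (hL : 0 < ζ x + L) (hu : 0 < 1 - Real.log (ζ x + L) / R) (hη : 0 ≤ η)
    (hβ : 0 ≤ β)
    (hlevi : ∀ v : Cn n, κ * (levi (fun y => barrier R L (ζ ((chartAt (Cn n) x).symm y)))
      (chartAt (Cn n) x x) v / 4) ≤
        β * quad ((g₁ t).coeff (chartAt (Cn n) x) (chartAt (Cn n) x x)) v)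
    (hclose : ∀ v : TangentSpace 𝓘(ℂ, Cn n) x,
      (g₂ a).normSq x v - (g₁ a).normSq x v ≤ η * (g₁ t).normSq x v)
    (hmax : IsLocalMax (fun y => (∫ s in a..t, ((g₂ s).logDet y - (g₁ s).logDet y)) -
      κ * barrier R L (ζ y)) x) :
    (g₂ t).logDet x - (g₁ t).logDet x ≤ n * Real.log (1 + η + β) := by
  set c := chartAt (Cn n) x with hcdef
  have hc : c ∈ atlas (Cn n) M := chart_mem_atlas _ x
  have hx : x ∈ c.source := mem_chart_source _ x
  have hz : c x ∈ c.target := c.map_source hx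
  have hxx : c.symm (c x) = x := c.left_inv hx
  have hf := hζ.contDiffAt x
  rw [← hcdef] at hf
  obtain ⟨hP, hPl⟩ := levi_integral_log_det hg₁ hg₂ hc ha hat htT hz
  have hb2 : ContDiffAt ℝ 2 (fun y => barrier R L (ζ (c.symm y))) (c x) := by
    refine ContDiffAt.comp (c x) (g := barrier R L) ?_ hf
    rw [hxx]
    exact contDiffAt_barrier hL hu
  have hlev2 : ∀ v, levi (fun y => κ * barrier R L (ζ (c.symm y))) (c x) v =
      κ * levi (fun y => barrier R L (ζ (c.symm y))) (c x) v := by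
    intro v
    have := levi_comp hb2 (φ := fun r => κ * r) (φ' := fun _ => κ) (φ'' := 0)
      (Eventually.of_forall fun r => by simpa using (hasDerivAt_id r).const_mul κ)
      (hasDerivAt_const _ _) v
    rw [this]; ring
  have hB : ContDiffAt ℝ 2 (fun y => κ * barrier R L (ζ (c.symm y))) (c x) :=
    contDiffAt_const.mul hb2
  have hloc : IsLocalMax (fun y => (∫ s in a..t,
      ((g₂ s).logDet (c.symm y) - (g₁ s).logDet (c.symm y))) -
        κ * barrier R L (ζ (c.symm y))) (c x) := by
    have htend : Tendsto c.symm (𝓝 (c x)) (𝓝 x) := by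
      have := c.symm.continuousAt hz
      rwa [ContinuousAt, hxx] at this
    have := htend.eventually hmax
    simpa only [IsLocalMax, IsMaxFilter, hxx] using this
  -- At the maximum ∂∂̄ of the potential is at most κ ∂∂̄b ≤ β g₁, and it equals (g₂ - g₁)(t) - (g₂
  -- - g₁)(a), where the last term is at most η g₁(t).
  have hquad : ∀ v, quad ((g₂ t).coeff c (c x)) v ≤
      (1 + η + β) * quad ((g₁ t).coeff c (c x)) v := by
    intro v
    have h1 := levi_nonpos_of_isLocalMax (hP.sub hB.twiceDifferentiableAt) hloc v
    rw [levi_sub hP hB.twiceDifferentiableAt, hlev2] at h1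
    have h2 := hPl v
    have h3 : quad ((g₂ a).coeff c (c x)) v - quad ((g₁ a).coeff c (c x)) v ≤
        η * quad ((g₁ t).coeff c (c x)) v := by
      simp only [HermitianMetric.quad_coeff]
      have : ∀ y, x = y → ∀ v : TangentSpace 𝓘(ℂ, Cn n) y,
          (g₂ a).normSq y v - (g₁ a).normSq y v ≤ η * (g₁ t).normSq y v := by
        rintro y rfl; exact hclose
      exact this _ hxx.symm _
    have h4 := hlevi v
    linarith
  have hdet := det_re_le_of_quad_le ((g₁ t).posDef_coeff hc hz) ((g₂ t).posDef_coeff hc hz) hquad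
  have hd1 := (g₁ t).det_coeff_re_pos hc hz
  have hd2 := (g₂ t).det_coeff_re_pos hc hz
  have hsub := HermitianMetric.log_det_coeff_sub (g₁ t) (g₂ t) hc hz
  rw [hxx] at hsub
  rw [← hsub, sub_le_iff_le_add, ← Real.log_pow, ← Real.log_mul (by positivity) hd1.ne']
  exact Real.log_le_log hd2 hdet

/-- The comparison of the potential with the barrier, on `log (ζ + K + 1) ≤ R / 2`. -/
theorem exists_integral_le_barrier (hT : 0 < T) (hg₁ : IsKahlerRicciFlow T g₁)
    (hg₂ : IsKahlerRicciFlow T g₂) (h0 : g₁ 0 = g₂ 0) (hζ : IsBoundedExhaustion ghat ζ)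
    {K : ℝ} (hK : 0 ≤ K) (hle : ∀ t ∈ Icc 0 T, ∀ x (v : TangentSpace 𝓘(ℂ, Cn n) x),
      ghat.normSq x v ≤ (ζ x + K) * (g₁ t).normSq x v) :
    ∃ C : ℝ, 0 ≤ C ∧ ∀ R η : ℝ, 1 ≤ R → 0 < η → ∀ x : M, Real.log (ζ x + (K + 1)) ≤ R / 2 →
      ∀ t ∈ Ioo 0 T,
        ∫ s in (0 : ℝ)..t, ((g₂ s).logDet x - (g₁ s).logDet x) ≤
          (n + 1) * (t + 1) *
            (Real.log (1 + 2 * η + C / R) + 2 * barrier R (K + 1) (ζ x)) := by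
  obtain ⟨C, hC0, hC⟩ := hζ.exists_levi_barrier_le hK
  refine ⟨2 * (n + 1) * (T + 1) * C, by positivity, fun R η hR hη x hx t ht => ?_⟩
  -- The barrier enters with the factor 2(n + 1)(t₀ + 1) ≤ 2(n + 1)(T + 1), so β absorbs its ∂∂̄ up
  -- to u⁻².
  set β := 2 * (n + 1) * (T + 1) * C / R with hβ
  have hR0 : 0 < R := by linarith
  have hβ0 : 0 ≤ β := by positivity
  -- The spatial estimate produces 1 + η; the second η makes the final inequality strict and gives
  -- log A > 0.
  set A := 1 + 2 * η + β with hA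
  have hA1 : 1 < A := by linarith
  have hlogA : 0 < Real.log A := Real.log_pos hA1
  have hT0 : (0 : ℝ) ≤ T := hT.le
  by_contra! hcon
  obtain ⟨F, hF⟩ : ∃ F : M → ℝ → ℝ, F = fun x s =>
    (g₂ (projIcc 0 T hT0 s)).logDet x - (g₁ (projIcc 0 T hT0 s)).logDet x := ⟨_, rfl⟩
  have hFc : Continuous (Function.uncurry F) := hF ▸ continuous_logDet_sub hT0 hg₁ hg₂
  have hFeq : ∀ y, ∀ a b, 0 ≤ a → a ≤ b → b ≤ T → ∫ s in a..b, F y s =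
      ∫ s in a..b, ((g₂ s).logDet y - (g₁ s).logDet y) := by
    intro y a b ha hab hb
    refine intervalIntegral.integral_congr fun s hs => ?_
    rw [uIcc_of_le hab] at hs
    simp only [hF, projIcc_of_mem hT0 (⟨ha.trans hs.1, hs.2.trans hb⟩ : s ∈ Icc 0 T)]
  rw [← hFeq x 0 t le_rfl ht.1.le ht.2.le] at hcon
  have hZ1 : ∀ y, 1 ≤ ζ y + (K + 1) := fun y => by have := hζ.pos y; linarith
  have hζc : Continuous ζ := hζ.contMDiff.continuous
  -- a bound for `F` on a large compact set
  have hKR : IsCompact ({y | ζ y ≤ Real.exp R} ×ˢ Icc (0 : ℝ) T) :=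
    (hζ.isCompact_le _).prod isCompact_Icc
  -- The bound is taken on {ζ ≤ exp R}, which contains `S` for every r ≤ 1, because r is chosen in
  -- terms of it.
  obtain ⟨B₀, hB₀⟩ := hKR.exists_bound_of_continuousOn hFc.continuousOn
  set B := max B₀ 0 with hBdef
  have hB : 0 ≤ B := le_max_right _ _
  -- With this r the barrier equals B T + 1 where log (ζ + K + 1) = r R, more than the potential can
  -- reach. Also r ≥ 1/2, which puts the given point into `S`.
  set r := 1 - Real.exp (-(B * T + 1)) with hr
  have hBT : 0 ≤ B * T := mul_nonneg hB hT0
  have hexp : Real.exp (-(B * T + 1)) ≤ 1 / 2 := by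
    have h1 : Real.exp (-(B * T + 1)) ≤ Real.exp (-1) := Real.exp_le_exp.2 (by linarith)
    have h2 := Real.exp_neg_one_lt_half
    linarith
  have hexp0 := Real.exp_pos (-(B * T + 1))
  have hu : ∀ y, Real.log (ζ y + (K + 1)) ≤ r * R →
      0 < 1 - Real.log (ζ y + (K + 1)) / R := by
    intro y hy
    have : Real.log (ζ y + (K + 1)) / R ≤ r := (div_le_iff₀ hR0).2 hy
    linarith
  set S := {y | Real.log (ζ y + (K + 1)) ≤ r * R} with hS
  have hSsub : S ⊆ {y | ζ y ≤ Real.exp R} := by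
    intro y hy
    have hy' : Real.log (ζ y + (K + 1)) ≤ r * R := hy
    have h1 : r * R ≤ R := mul_le_of_le_one_left hR0.le (by linarith)
    have h2 : ζ y + (K + 1) ≤ Real.exp R :=
      (Real.log_le_iff_le_exp (by linarith [hZ1 y])).1 (hy'.trans h1)
    simp only [mem_ofPred_eq]
    linarith
  have hlogc : Continuous fun y => Real.log (ζ y + (K + 1)) :=
    Continuous.log (by fun_prop) fun y => by linarith [hZ1 y]
  have hSc : IsCompact S :=
    (hζ.isCompact_le _).of_isClosed_subset (isClosed_le hlogc continuous_const) hSsub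
  have hxS : x ∈ S := by
    have h1 : 1 / 2 * R ≤ r * R := mul_le_mul_of_nonneg_right (by linarith) hR0.le
    simp only [hS, mem_ofPred_eq]
    linarith
  -- the initial time
  have hprim : ∀ a₀, Continuous fun p : M × ℝ => ∫ s in a₀..p.2, F p.1 s := fun a₀ =>
    intervalIntegral.continuous_parametric_primitive_of_continuous hFc
  -- A small δ > 0 keeps the integral within the times of smoothness, makes the initial error at
  -- most η g₁ on `S`, and preserves the strict inequality to be refuted.
  obtain ⟨δ, ⟨⟨hδ0, hδt⟩, hclose⟩, hδ⟩ : ∃ δ, (δ ∈ Ioo 0 t ∧ (δ ∈ Icc 0 T → ∀ x ∈ S,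
      ∀ t ∈ Icc 0 T, ∀ v : TangentSpace 𝓘(ℂ, Cn n) x,
        (g₂ δ).normSq x v - (g₁ δ).normSq x v ≤ η * (g₁ t).normSq x v)) ∧
      (n + 1) * (t + 1) * (Real.log A + 2 * barrier R (K + 1) (ζ x)) <
        ∫ s in δ..t, F x s := by
    have e1 : ∀ᶠ δ in 𝓝[>] (0 : ℝ), δ ∈ Ioo 0 t := Ioo_mem_nhdsGT ht.1
    have e2 := (eventually_normSq_sub_le hT0 hg₁ hg₂ h0 hSc hη).filter_mono
      (nhdsWithin_le_nhds (s := Ioi 0))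
    have hcont : Continuous fun δ => ∫ s in δ..t, F x s := by
      have h1 : Continuous fun δ => ∫ s in t..δ, F x s :=
        (hprim t).comp (Continuous.prodMk_right x)
      simp only [intervalIntegral.integral_symm t]
      exact h1.neg
    have e3 : ∀ᶠ δ in 𝓝[>] (0 : ℝ), (n + 1) * (t + 1) *
        (Real.log A + 2 * barrier R (K + 1) (ζ x)) < ∫ s in δ..t, F x s :=
      (hcont.continuousAt.eventually (lt_mem_nhds hcon)).filter_mono nhdsWithin_le_nhds
    obtain ⟨δ, h⟩ := ((e1.and e2).and e3).exists
    exact ⟨δ, h⟩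
  replace hclose := hclose ⟨hδ0.le, hδt.le.trans ht.2.le⟩
  -- the maximum
  set W : M × ℝ → ℝ := fun p => (∫ s in δ..p.2, F p.1 s) -
    (n + 1) * (p.2 + 1) * (Real.log A + 2 * barrier R (K + 1) (ζ p.1)) with hW
  have hWc : ContinuousOn W (S ×ˢ Icc δ t) := by
    refine (hprim δ).continuousOn.sub (ContinuousOn.mul (by fun_prop) (continuousOn_const.add
      (continuousOn_const.mul ?_)))
    simp only [barrier]
    refine (ContinuousOn.log ?_ fun p hp => (hu p.1 hp.1).ne').neg
    exact (continuous_const.sub ((hlogc.comp continuous_fst).div_const R)).continuousOn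
  obtain ⟨⟨x₀, t₀⟩, ⟨hx₀, ht₀⟩, hmax⟩ := (hSc.prod isCompact_Icc).exists_isMaxOn
    ⟨(x, t), hxS, hδt.le, le_rfl⟩ hWc
  have hWpos : 0 < W (x₀, t₀) := by
    have h1 : W (x, t) ≤ W (x₀, t₀) := hmax ⟨hxS, hδt.le, le_rfl⟩
    have h2 : 0 < W (x, t) := by simp only [hW]; linarith
    linarith
  have hx₀' : Real.log (ζ x₀ + (K + 1)) ≤ r * R := hx₀
  have hu₀ := hu x₀ hx₀'
  have hb₀ := barrier_nonneg hR0 (hZ1 x₀) hu₀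
  have ht₀0 : 0 < t₀ := hδ0.trans_le ht₀.1
  have ht₀T : t₀ < T := ht₀.2.trans_lt ht.2
  have ht₀m : t₀ ∈ Icc 0 T := ⟨ht₀0.le, ht₀T.le⟩
  have hm1 : (1 : ℝ) ≤ (n + 1) * (t₀ + 1) := by
    have : (0 : ℝ) ≤ n := Nat.cast_nonneg n
    exact one_le_mul_of_one_le_of_one_le (by linarith) (by linarith)
  -- At time δ the integral is empty, so W ≤ 0 there.
  have hδt₀ : δ < t₀ := by
    rcases ht₀.1.lt_or_eq with h | h
    · exact h
    · exfalso
      have h1 : W (x₀, t₀) = -((n + 1) * (t₀ + 1) *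
          (Real.log A + 2 * barrier R (K + 1) (ζ x₀))) := by
        simp only [hW, h, intervalIntegral.integral_same, zero_sub]
      have h2 : 0 ≤ (n + 1) * (t₀ + 1) * (Real.log A + 2 * barrier R (K + 1) (ζ x₀)) := by
        positivity
      linarith
  -- On the edge of `S` the barrier is B T + 1 while the integral is at most B T, so W < 0; hence x₀
  -- is interior and a local maximum in space.
  have hx₀lt : Real.log (ζ x₀ + (K + 1)) < r * R := by
    refine lt_of_le_of_ne hx₀' fun h => ?_
    have h1 : barrier R (K + 1) (ζ x₀) = B * T + 1 := by
      rw [barrier, h, mul_div_cancel_right₀ _ hR0.ne', hr, sub_sub_cancel, Real.log_exp, neg_neg]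
    have h2 : ‖∫ s in δ..t₀, F x₀ s‖ ≤ B * |t₀ - δ| := by
      refine intervalIntegral.norm_integral_le_of_norm_le_const fun s hs => ?_
      rw [uIoc_of_le hδt₀.le] at hs
      exact (hB₀ (x₀, s) ⟨hSsub hx₀, (hδ0.trans hs.1).le, hs.2.trans ht₀T.le⟩).trans
        (le_max_left _ _)
    have h3 : B * |t₀ - δ| ≤ B * T := by
      refine mul_le_mul_of_nonneg_left ?_ hB
      rw [abs_of_pos (sub_pos.2 hδt₀)]
      linarith
    have h4 := (le_abs_self _).trans (h2.trans h3)
    have h5 : Real.log A + 2 * barrier R (K + 1) (ζ x₀) ≤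
        (n + 1) * (t₀ + 1) * (Real.log A + 2 * barrier R (K + 1) (ζ x₀)) :=
      le_mul_of_one_le_left (by positivity) hm1
    simp only [hW] at hWpos
    rw [h1] at h5 hWpos
    linarith
  -- the time derivative
  have htime : 0 ≤ F x₀ t₀ - (n + 1) * (Real.log A + 2 * barrier R (K + 1) (ζ x₀)) := by
    have hd1 : HasDerivAt (fun τ => ∫ s in δ..τ, F x₀ s) (F x₀ t₀) t₀ := by
      have hFx : Continuous (F x₀) := hFc.comp (Continuous.prodMk_right x₀)
      exact (hFx.integral_hasStrictDerivAt δ t₀).hasDerivAt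
    have hd2 : HasDerivAt (fun τ : ℝ => (n + 1) * (τ + 1) *
        (Real.log A + 2 * barrier R (K + 1) (ζ x₀)))
        ((n + 1) * (Real.log A + 2 * barrier R (K + 1) (ζ x₀))) t₀ := by
      simpa using ((((hasDerivAt_id t₀).add_const 1).const_mul ((n : ℝ) + 1)).mul_const
        (Real.log A + 2 * barrier R (K + 1) (ζ x₀)))
    refine deriv_nonneg_of_le_left (f := fun τ => W (x₀, τ)) (hd1.sub hd2) hδt₀ fun s hs => ?_
    exact hmax (⟨hx₀, hs.1, hs.2.trans ht₀.2⟩ : (x₀, s) ∈ S ×ˢ Icc δ t)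
  -- the space derivatives
  set u := 1 - Real.log (ζ x₀ + (K + 1)) / R with hudef
  have hspace : (g₂ t₀).logDet x₀ - (g₁ t₀).logDet x₀ ≤
      n * Real.log (1 + η + β * u⁻¹ ^ 2) := by
    refine logDet_sub_le_of_isLocalMax hg₁ hg₂ hζ (L := K + 1) (R := R)
      (κ := (n + 1) * (t₀ + 1) * 2) hδ0 hδt₀.le ht₀T (by linarith [hZ1 x₀]) hu₀ hη.le
      (by positivity) (fun v => ?_) (hclose x₀ hx₀ t₀ ht₀m) ?_
    · have hCv := hC (g₁ t₀) (hle t₀ ht₀m) R hR x₀ hu₀ v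
      have hq0 := (g₁ t₀).quad_coeff_nonneg (chart_mem_atlas _ x₀)
          ((chartAt (Cn n) x₀).map_source (mem_chart_source _ x₀)) v
      refine (mul_le_mul_of_nonneg_left hCv (by positivity)).trans ?_
      rw [← mul_assoc]
      refine mul_le_mul_of_nonneg_right ?_ hq0
      rw [← mul_assoc, ← hudef]
      refine mul_le_mul_of_nonneg_right ?_ (by positivity)
      rw [hβ, mul_div_assoc]
      refine mul_le_mul_of_nonneg_right ?_ (by positivity)
      have : (n + 1 : ℝ) * (t₀ + 1) ≤ (n + 1) * (T + 1) := by gcongr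
      linarith
    · have hnear : ∀ᶠ y in 𝓝 x₀, y ∈ S := by
        filter_upwards [hlogc.continuousAt.eventually (gt_mem_nhds hx₀lt)] with y hy using hy.le
      filter_upwards [hnear] with y hy
      have h1 : W (y, t₀) ≤ W (x₀, t₀) := hmax ⟨hy, ht₀⟩
      simp only [hW] at h1
      rw [hFeq _ _ _ hδ0.le hδt₀.le ht₀T.le, hFeq _ _ _ hδ0.le hδt₀.le ht₀T.le] at h1
      linarith
  have hFx₀ : F x₀ t₀ = (g₂ t₀).logDet x₀ - (g₁ t₀).logDet x₀ := by
    simp only [hF, projIcc_of_mem hT0 ht₀m]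
  have hu1 : 1 ≤ u⁻¹ ^ 2 := by
    refine one_le_pow₀ ((one_le_inv₀ hu₀).2 ?_)
    have : 0 ≤ Real.log (ζ x₀ + (K + 1)) / R := div_nonneg (Real.log_nonneg (hZ1 x₀)) hR0.le
    linarith
  -- Factoring out u⁻² turns its logarithm into 2b, the term present in the comparison function.
  have hlt : 1 + η + β * u⁻¹ ^ 2 < A * u⁻¹ ^ 2 := by
    have h1 : (1 + 2 * η) * 1 ≤ (1 + 2 * η) * u⁻¹ ^ 2 :=
      mul_le_mul_of_nonneg_left hu1 (by linarith)
    rw [hA, add_mul]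
    linarith
  have hone : 1 < 1 + η + β * u⁻¹ ^ 2 := by
    have : 0 ≤ β * u⁻¹ ^ 2 := by positivity
    linarith
  have hlog1 := Real.log_lt_log (by linarith) hlt
  have hlog0 := Real.log_pos hone
  rw [Real.log_mul (by linarith) (by positivity), Real.log_pow, Real.log_inv] at hlog1
  rw [hFx₀, barrier, ← hudef] at htime
  push_cast at hlog1
  -- Now F ≤ n log(1 + η + β u⁻²) ≤ (n + 1) log(1 + η + β u⁻²) < (n + 1)(log A + 2b) ≤ F, a
  -- contradiction. The factor n + 1 keeps the strict inequality also for n = 0.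
  have hlog2 := mul_lt_mul_of_pos_left hlog1 (by positivity : (0 : ℝ) < n + 1)
  linarith

/-- The potential is nonpositive. -/
theorem integral_logDet_sub_nonpos (hT : 0 < T) (hg₁ : IsKahlerRicciFlow T g₁)
    (hg₂ : IsKahlerRicciFlow T g₂) (h0 : g₁ 0 = g₂ 0) (hζ : IsBoundedExhaustion ghat ζ)
    {K : ℝ} (hK : 0 ≤ K) (hle : ∀ t ∈ Icc 0 T, ∀ x (v : TangentSpace 𝓘(ℂ, Cn n) x),
      ghat.normSq x v ≤ (ζ x + K) * (g₁ t).normSq x v) (x : M) {t : ℝ} (ht : t ∈ Ioo 0 T) :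
    ∫ s in (0 : ℝ)..t, ((g₂ s).logDet x - (g₁ s).logDet x) ≤ 0 := by
  obtain ⟨C, hC0, hC⟩ := exists_integral_le_barrier hT hg₁ hg₂ h0 hζ hK hle
  have hlim : Tendsto (fun R : ℝ => (n + 1) * (t + 1) *
      (Real.log (1 + 2 * R⁻¹ + C / R) + 2 * barrier R (K + 1) (ζ x))) atTop (𝓝 0) := by
    have hinv : Tendsto (fun R : ℝ => R⁻¹) atTop (𝓝 0) := tendsto_inv_atTop_zero
    have hdiv : ∀ a : ℝ, Tendsto (fun R : ℝ => a / R) atTop (𝓝 0) := fun a =>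
      tendsto_const_nhds.div_atTop tendsto_id
    have h1 : Tendsto (fun R : ℝ => Real.log (1 + 2 * R⁻¹ + C / R)) atTop (𝓝 0) := by
      have := ((tendsto_const_nhds (x := (1 : ℝ))).add (hinv.const_mul 2)).add (hdiv C)
      simp only [mul_zero, add_zero] at this
      simpa using this.log one_ne_zero
    have h2 : Tendsto (fun R : ℝ => barrier R (K + 1) (ζ x)) atTop (𝓝 0) := by
      have := (tendsto_const_nhds (x := (1 : ℝ))).sub (hdiv (Real.log (ζ x + (K + 1))))
      simp only [sub_zero] at this
      simpa [barrier] using (this.log one_ne_zero).neg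
    simpa using (h1.add (h2.const_mul 2)).const_mul ((n + 1) * (t + 1))
  -- With η = 1 / R the bound tends to 0 at the fixed point x, which satisfies log (ζ + K + 1) ≤ R /
  -- 2 once R is large.
  refine ge_of_tendsto hlim ?_
  filter_upwards [eventually_ge_atTop (1 : ℝ),
    eventually_ge_atTop (2 * Real.log (ζ x + (K + 1)))] with R hR1 hR2
  exact hC R R⁻¹ hR1 (by positivity) x (by linarith) t ht

/-- Two solutions of the Kähler-Ricci flow that start from the same metric and dominate
`ghat / (ζ + K)` coincide. -/
theorem eq_of_le (hT : 0 < T) (hg₁ : IsKahlerRicciFlow T g₁)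
    (hg₂ : IsKahlerRicciFlow T g₂) (h0 : g₁ 0 = g₂ 0) (hζ : IsBoundedExhaustion ghat ζ)
    {K : ℝ} (hK : 0 ≤ K)
    (hle₁ : ∀ t ∈ Icc 0 T, ∀ x (v : TangentSpace 𝓘(ℂ, Cn n) x),
      ghat.normSq x v ≤ (ζ x + K) * (g₁ t).normSq x v)
    (hle₂ : ∀ t ∈ Icc 0 T, ∀ x (v : TangentSpace 𝓘(ℂ, Cn n) x),
      ghat.normSq x v ≤ (ζ x + K) * (g₂ t).normSq x v) {t : ℝ} (ht : t ∈ Icc 0 T) :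
    g₁ t = g₂ t := by
  have hT0 := hT.le
  have hlog : ∀ x, ∀ s ∈ Ioo 0 T, (g₂ s).logDet x = (g₁ s).logDet x := by
    intro x s hs
    obtain ⟨F, hF⟩ : ∃ F : ℝ → ℝ, F = fun s =>
      (g₂ (projIcc 0 T hT0 s)).logDet x - (g₁ (projIcc 0 T hT0 s)).logDet x := ⟨_, rfl⟩
    have hFc : Continuous F := by
      rw [hF]
      exact (continuous_logDet_sub hT0 hg₁ hg₂).comp (f := fun s : ℝ => (x, s)) (by fun_prop)
    -- Exchanging the two flows reverses the sign of the potential, so it is both nonpositive and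
    -- nonnegative.
    have hzero : ∀ τ ∈ Ioo 0 T, ∫ s in (0 : ℝ)..τ, F s = 0 := by
      intro τ hτ
      have e1 : ∫ s in (0 : ℝ)..τ, F s =
          ∫ s in (0 : ℝ)..τ, ((g₂ s).logDet x - (g₁ s).logDet x) := by
        refine intervalIntegral.integral_congr fun s hs => ?_
        rw [uIcc_of_le hτ.1.le] at hs
        simp only [hF, projIcc_of_mem hT0 (⟨hs.1, hs.2.trans hτ.2.le⟩ : s ∈ Icc 0 T)]
      have h1 := integral_logDet_sub_nonpos hT hg₁ hg₂ h0 hζ hK hle₁ x hτ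
      have h2 := integral_logDet_sub_nonpos hT hg₂ hg₁ h0.symm hζ hK hle₂ x hτ
      have h3 : ∫ s in (0 : ℝ)..τ, ((g₁ s).logDet x - (g₂ s).logDet x) =
          -∫ s in (0 : ℝ)..τ, ((g₂ s).logDet x - (g₁ s).logDet x) := by
        rw [← intervalIntegral.integral_neg]
        simp only [neg_sub]
      rw [e1]
      linarith
    have hd1 : HasDerivAt (fun τ => ∫ s in (0 : ℝ)..τ, F s) (F s) s :=
      (hFc.integral_hasStrictDerivAt 0 s).hasDerivAt
    have hd2 : HasDerivAt (fun τ => ∫ s in (0 : ℝ)..τ, F s) 0 s := by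
      refine (hasDerivAt_const s (0 : ℝ)).congr_of_eventuallyEq ?_
      filter_upwards [isOpen_Ioo.mem_nhds hs] with τ hτ using hzero τ hτ
    have := hd1.unique hd2
    simp only [hF, projIcc_of_mem hT0 (Ioo_subset_Icc_self hs)] at this
    linarith
  refine HermitianMetric.ext_coeff fun c hc z hz i j => ?_
  have hcont : ∀ g, IsKahlerRicciFlow T g →
      ContinuousOn (fun s => (g s).coeff c z i j) (Icc 0 T) := fun g hg =>
    (hg.continuous c hc i j).comp (f := fun s => (s, z)) (by fun_prop) fun s hs => ⟨hs, hz⟩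
  -- Equal determinants have the same ∂∂̄ log det, so both metrics have the same time derivative.
  have hderiv : ∀ s ∈ Ioo 0 T, HasDerivAt
      (fun s => (g₁ s).coeff c z i j - (g₂ s).coeff c z i j) 0 s := by
    intro s hs
    have h1 := (hg₁.flow c hc z hz s hs i j).sub (hg₂.flow c hc z hz s hs i j)
    rw [hg₁.neg_ricci_eq hc hs hz, hg₂.neg_ricci_eq hc hs hz] at h1
    have hev : (fun y => (Real.log ((g₁ s).coeff c y).det.re : ℂ)) =ᶠ[𝓝 z]
        fun y => (Real.log ((g₂ s).coeff c y).det.re : ℂ) := by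
      filter_upwards [c.open_target.mem_nhds hz] with y hy
      have h2 := HermitianMetric.log_det_coeff_sub (g₁ s) (g₂ s) hc hy
      rw [hlog _ s hs, sub_self, sub_eq_zero] at h2
      rw [h2]
    have h3 : dz i (dzbar j fun y => (Real.log ((g₁ s).coeff c y).det.re : ℂ)) z =
        dz i (dzbar j fun y => (Real.log ((g₂ s).coeff c y).det.re : ℂ)) z := by
      refine dz_congr ?_ i
      filter_upwards [hev.fderiv (𝕜 := ℝ)] with y hy
      simp only [dzbar, hy]
    rwa [h3, sub_self] at h1
  have hc12 := (hcont g₁ hg₁).sub (hcont g₂ hg₂)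
  rcases ht.1.eq_or_lt with rfl | ht0
  · rw [h0]
  -- The equation holds only for positive times: the difference is constant on (0, t], and
  -- continuity at 0 identifies the constant with the initial difference.
  have hconst : ∀ a ∈ Ioc 0 t, (g₁ t).coeff c z i j - (g₂ t).coeff c z i j =
      (g₁ a).coeff c z i j - (g₂ a).coeff c z i j := by
    intro a ha
    refine constant_of_has_deriv_right_zero
      (f := fun s => (g₁ s).coeff c z i j - (g₂ s).coeff c z i j) (a := a) (b := t)
      (hc12.mono (Icc_subset_Icc ha.1.le ht.2)) (fun s hs => ?_) t ⟨ha.2, le_rfl⟩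
    exact (hderiv s ⟨ha.1.trans_le hs.1, hs.2.trans_le ht.2⟩).hasDerivWithinAt
  have hlim : Tendsto (fun s => (g₁ s).coeff c z i j - (g₂ s).coeff c z i j) (𝓝[>] 0)
      (𝓝 ((g₁ 0).coeff c z i j - (g₂ 0).coeff c z i j)) := by
    have h1 := hc12 0 ⟨le_rfl, hT0⟩
    rw [← nhdsWithin_Ioc_eq_nhdsGT hT]
    exact h1.mono_left (nhdsWithin_mono _ Ioc_subset_Icc_self)
  have hlim2 : Tendsto (fun s => (g₁ s).coeff c z i j - (g₂ s).coeff c z i j) (𝓝[>] 0)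
      (𝓝 ((g₁ t).coeff c z i j - (g₂ t).coeff c z i j)) := by
    refine tendsto_const_nhds.congr' ?_
    filter_upwards [Ioc_mem_nhdsGT ht0] with a ha using hconst a ha
  have := tendsto_nhds_unique hlim2 hlim
  rw [h0, sub_self] at this
  exact sub_eq_zero.1 this

end IsKahlerRicciFlow

end MaximumPrinciple

end KahlerFlow

end

/-! ### Both parts of the uniqueness theorem -/

open KahlerFlow in
theorem mainTheorem4 {n : ℕ} {M : Type*} [TopologicalSpace M] [T2Space M]
    [SecondCountableTopology M] [NoncompactSpace M]
    [ChartedSpace (Cn n) M] [IsManifold 𝓘(ℂ, Cn n) ω M]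
    (ghat : HermitianMetric n M) (hK : ghat.IsKahler) (hcomplete : ghat.IsComplete)
    (ζ : M → ℝ) (hζ : IsBoundedExhaustion ghat ζ)
    {T : ℝ} (hT : 0 < T) (g₁ g₂ : ℝ → HermitianMetric n M)
    (h₁ : IsKahlerRicciFlow T g₁) (h₂ : IsKahlerRicciFlow T g₂)
    (hinit : g₁ 0 = g₂ 0) :
    (∀ σ : M → ℝ, (∀ x, 0 < σ x) →
      Tendsto (fun x => Real.log (σ x) / Real.log (ζ x)) (cocompact M) (𝓝 0) →
      (∀ t ∈ Icc 0 T, ∀ (x : M) (v : TangentSpace 𝓘(ℂ, Cn n) x),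
        ghat.normSq x v ≤ ζ x * (g₁ t).normSq x v ∧
        ghat.normSq x v ≤ ζ x * (g₂ t).normSq x v) →
      (∀ t ∈ Icc 0 T, ∀ x : M, ∀ c ∈ atlas (Cn n) M, x ∈ c.source →
        -σ x ≤ detRatio (g₁ t) (g₂ t) c x ∧ detRatio (g₁ t) (g₂ t) c x ≤ σ x) →
      ∀ t ∈ Icc 0 T, g₁ t = g₂ t) ∧
    (UniformlyEquivalent T g₁ ghat → UniformlyEquivalent T g₂ ghat →
      ∀ t ∈ Icc 0 T, g₁ t = g₂ t) := by
  refine ⟨fun σ _ _ hle _ t ht => ?_, fun hU₁ hU₂ t ht => ?_⟩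
  -- Condition (i) is the case K = 0.
  · refine h₁.eq_of_le hT h₂ hinit hζ le_rfl (fun t ht x v => ?_) (fun t ht x v => ?_) ht
    · simpa using (hle t ht x v).1
    · simpa using (hle t ht x v).2
  · obtain ⟨K₁, hK₁, hU₁⟩ := hU₁
    obtain ⟨K₂, hK₂, hU₂⟩ := hU₂
    -- Uniform equivalence gives ĝ ≤ k g, and k ≤ ζ + K₁ + K₂ because ζ > 0. The shift is needed
    -- since ζ may be small, and the sum serves both flows.
    have key : ∀ (g : HermitianMetric n M) (k : ℝ), 0 < k → k ≤ K₁ + K₂ →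
        ∀ (x : M) (v : TangentSpace 𝓘(ℂ, Cn n) x), k⁻¹ * ghat.normSq x v ≤ g.normSq x v →
          ghat.normSq x v ≤ (ζ x + (K₁ + K₂)) * g.normSq x v := by
      intro g k hk hk' x v h
      have hn : 0 ≤ g.normSq x v := by
        by_cases hv : v = 0
        · simp [HermitianMetric.normSq, hv]
        · exact (g.pos x v hv).le
      have h1 : ghat.normSq x v ≤ k * g.normSq x v := by
        rwa [inv_mul_le_iff₀ hk] at h
      exact h1.trans (mul_le_mul_of_nonneg_right (by have := hζ.pos x; linarith) hn)
    refine h₁.eq_of_le hT h₂ hinit hζ (K := K₁ + K₂) (by positivity) (fun t ht x v => ?_)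
      (fun t ht x v => ?_) ht
    · exact key (g₁ t) K₁ hK₁ (by linarith) x v (hU₁ t ht x v).1
    · exact key (g₂ t) K₂ hK₂ (by linarith) x v (hU₂ t ht x v).1
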